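/- Let $n_t,T\ge 1$ and $n_r\ge n_t$ be integers and put $\kappa=n_tT$. Consider the channel $\mathbf Y=\mathbf H\mathbf X+\mathbf W$, where $\mathbf H\in\mathbb C^{n_r\times n_t}$ and $\mathbf W\in\mathbb C^{n_r\times T}$ have i.i.d. standard circularly symmetric complex Gaussian entries and $\mathbf X\in\mathbb C^{n_t\times T}$ is drawn uniformly from a finite codebook $\mathcal X=\mathcal X(\rho)$; $\mathbf X,\mathbf H,\mathbf W$ are independent. The code is full-rate linear dispersive: $\mathcal X=\{\theta\sum_{i=1}^{\kappa}s_i\mathbf D_i : s_i\in\mathbb S_\eta\}$, where $\mathbf D_1,\dots,\mathbf D_\kappa\in\mathbb C^{n_t\times T}$ are linearly independent, $\mathbb S_\eta=\{s\in\mathbb C:\Re(s),\Im(s)\in\mathbb Z\cap[-\eta,\eta]\}$, and $\theta=\theta(\rho)>0$, $\eta=\eta(\rho)>0$ are such that $\frac1{|\mathcal X|}\sum_{\mathbf X\in\mathcal X}\|\mathbf X\|_F^2=\rho T$ for all sufficiently large $\rho$, and such that the code has multiplexing gain $r=\lim_{\rho\to\infty}\frac1T\frac{\log|\mathcal X|}{\log\rho}$.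 Let $\hat{\mathbf X}_{ML}$ be a maximum-likelihood decision, i.e. a minimizer of $\|\mathbf Y-\mathbf H\hat{\mathbf X}\|_F^2$ over $\hat{\mathbf X}\in\mathcal X$, and suppose that the code has (finite) diversity gain $d(r)=-\lim_{\rho\to\infty}\frac{\log P(\hat{\mathbf X}_{ML}\ne\mathbf X)}{\log\rho}$. Let $\mathbf G=[\mathrm{vec}(\mathbf D_1)\cdots\mathrm{vec}(\mathbf D_\kappa)]$, let $\mathbf Q\mathbf R=\theta(\mathbf I_T\otimes\mathbf H)\mathbf G$ be a thin QR-decomposition ($\mathbf Q^H\mathbf Q=\mathbf I$, $\mathbf R\in\mathbb C^{\kappa\times\kappa}$ upper triangular), and let $\mathbf r=\mathbf Q^H\mathrm{vec}(\mathbf Y)$. The sphere decoder with non-random search radius $\xi=\xi(\rho)>0$, where $\lim_{\rho\to\infty}\frac{\log\xi}{\log\rho}=0$ (for example $\xi^2=z\log\rho$ with $z>d(r)$), visits $$N=\sum_{k=1}^{\kappa}\bigl|\{\hat{\mathbf s}\in\mathbb S_\eta^k:\|\mathbf r_k-\mathbf R_k\hat{\mathbf s}\|^2\le\xi^2\}\bigr|$$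 nodes, where $\mathbf r_k$ consists of the last $k$ entries of $\mathbf r$ and $\mathbf R_k$ is the lower right $k\times k$ corner of $\mathbf R$. With $$\Psi(x)=\liminf_{\rho\to\infty}\Bigl(-\frac{\log P(N\ge\rho^x)}{\log\rho}\Bigr)\in[-\infty,\infty]$$ (where $-\log 0=\infty$; this is the limit whenever the limit exists), the SD complexity exponent is $c(r)=\inf\{x\in\mathbb R:\Psi(x)>d(r)\}$. Then the maximum $$\bar c(r)=\max_{\alpha}\ \sum_{i=1}^{n_t}T\,\min\Bigl(\frac r{n_t}-1+\alpha_i,\ \frac r{n_t}\Bigr)^{+}$$ over all $\alpha\in\mathbb R^{n_t}$ with $\alpha_1\ge\dots\ge\alpha_{n_t}\ge0$ and $\sum_{i=1}^{n_t}(n_r-n_t+2i-1)\alpha_i\le d(r)$ is attained, and $c(r)\le\bar c(r)$. Here $(a)^+=\max(a,0)$. -/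

import Mathlib

open Filter Topology MeasureTheory ProbabilityTheory
open scoped Kronecker NNReal ENNReal Matrix

noncomputable section

namespace SphereDecoding

/-- Squared Euclidean norm of a complex vector. -/
def sqNorm {ι : Type*} [Fintype ι] (v : ι → ℂ) : ℝ := ∑ i, ‖v i‖ ^ 2

/-- Squared Frobenius norm of a complex matrix. -/
def frobSq {m n : Type*} [Fintype m] [Fintype n] (A : Matrix m n ℂ) : ℝ :=
  ∑ i, ∑ j, ‖A i j‖ ^ 2

/-! ### Codes -/

/-- The QAM alphabet of size parameter `η`: the complex numbers whose real and imaginary parts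
are integers in `[-η, η]` (see `mem_constellation`). -/
def constellation (η : ℝ) : Finset ℂ :=
  (Finset.Icc (-⌊η⌋) ⌊η⌋ ×ˢ Finset.Icc (-⌊η⌋) ⌊η⌋).image
    fun p : ℤ × ℤ => (⟨(p.1 : ℝ), (p.2 : ℝ)⟩ : ℂ)

theorem mem_constellation {η : ℝ} {s : ℂ} :
    s ∈ constellation η ↔
      ∃ a b : ℤ, |(a : ℝ)| ≤ η ∧ |(b : ℝ)| ≤ η ∧ s.re = a ∧ s.im = b := by
  have key : ∀ a : ℤ, (-⌊η⌋ ≤ a ∧ a ≤ ⌊η⌋) ↔ |(a : ℝ)| ≤ η := by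
    intro a
    rw [abs_le, Int.le_floor, neg_le, Int.le_floor, Int.cast_neg, neg_le]
  constructor
  · intro h
    obtain ⟨p, hp, rfl⟩ := Finset.mem_image.1 h
    rw [Finset.mem_product, Finset.mem_Icc, Finset.mem_Icc, key, key] at hp
    exact ⟨p.1, p.2, hp.1, hp.2, rfl, rfl⟩
  · rintro ⟨a, b, ha, hb, hre, him⟩
    refine Finset.mem_image.2 ⟨(a, b), ?_, ?_⟩
    · rw [Finset.mem_product, Finset.mem_Icc, Finset.mem_Icc, key, key]
      exact ⟨ha, hb⟩
    · exact Complex.ext hre.symm him.symm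

/-- The vectors of length `k` with entries in the alphabet of size parameter `η`. -/
def symbolVectors (k : ℕ) (η : ℝ) : Finset (Fin k → ℂ) :=
  Fintype.piFinset fun _ => constellation η

/-- A full-rate linear dispersive code (a family of codebooks indexed by the SNR `ρ`) for
`nt` transmit antennas and `T` channel uses: `κ = nt * T` linearly independent dispersion
matrices, and, for each SNR, the alphabet size parameter `eta` and the power scaling `theta`. -/
structure LDCode (nt T : ℕ) where
  dispersion : Fin (nt * T) → Matrix (Fin nt) (Fin T) ℂ
  linearIndependent : LinearIndependent ℂ dispersion
  eta : ℝ → ℝ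
  theta : ℝ → ℝ
  eta_pos : ∀ ρ, 0 < eta ρ
  theta_pos : ∀ ρ, 0 < theta ρ

namespace LDCode

variable {nt T : ℕ} (C : LDCode nt T)

/-- The codeword `θ ∑ᵢ sᵢ Dᵢ` carrying the symbols `s`. -/
def encode (ρ : ℝ) (s : Fin (nt * T) → ℂ) : Matrix (Fin nt) (Fin T) ℂ :=
  (C.theta ρ : ℂ) • ∑ i, s i • C.dispersion i

open Classical in
/-- The codebook at SNR `ρ`. -/
def codebook (ρ : ℝ) : Finset (Matrix (Fin nt) (Fin T) ℂ) :=
  (symbolVectors (nt * T) (C.eta ρ)).image (C.encode ρ)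

/-- The power constraint `E ‖X‖² = ρ T` for codewords drawn uniformly from the codebook,
required for all sufficiently large `ρ`. -/
def PowerConstraint : Prop :=
  ∀ᶠ ρ : ℝ in atTop,
    1 / ((C.codebook ρ).card : ℝ) * ∑ X ∈ C.codebook ρ, frobSq X = ρ * T

/-- The code has multiplexing gain `r`. -/
def HasMultiplexingGain (r : ℝ) : Prop :=
  Tendsto (fun ρ : ℝ => 1 / (T : ℝ) * (Real.log ((C.codebook ρ).card : ℝ) / Real.log ρ))
    atTop (𝓝 r)

/-- The generator matrix, whose columns are the vectorized dispersion matrices. -/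
def generator : Matrix (Fin T × Fin nt) (Fin (nt * T)) ℂ :=
  Matrix.of fun p i => Matrix.vec (C.dispersion i) p

/-- The code-channel generator matrix `θ (I_T ⊗ H) G`. -/
def codeChannel {nr : ℕ} (ρ : ℝ) (H : Matrix (Fin nr) (Fin nt) ℂ) :
    Matrix (Fin T × Fin nr) (Fin (nt * T)) ℂ :=
  (C.theta ρ : ℂ) • (((1 : Matrix (Fin T) (Fin T) ℂ) ⊗ₖ H) * C.generator)

end LDCode

/-! ### The channel `Y = H X + W` -/

/-- The standard circularly symmetric complex Gaussian law (independent real and imaginary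
parts, each of mean zero and variance `1/2`). -/
def complexGaussian : Measure ℂ :=
  ((gaussianReal 0 (1 / 2)).prod (gaussianReal 0 (1 / 2))).map
    fun p : ℝ × ℝ => (⟨p.1, p.2⟩ : ℂ)

/-- The law of an `m × n` array with i.i.d. standard complex Gaussian entries. -/
def gaussianArray (m n : ℕ) : Measure (Fin m → Fin n → ℂ) :=
  Measure.pi fun _ => Measure.pi fun _ => complexGaussian

/-- Outcomes: the transmitted codeword `X`, the channel `H` and the noise `W`. -/
abbrev Outcome (nt nr T : ℕ) : Type :=
  (Fin nt → Fin T → ℂ) × (Fin nr → Fin nt → ℂ) × (Fin nr → Fin T → ℂ)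

namespace Outcome

variable {nt nr T : ℕ}

/-- The transmitted codeword. -/
def X (ω : Outcome nt nr T) : Matrix (Fin nt) (Fin T) ℂ := Matrix.of ω.1

/-- The channel matrix. -/
def H (ω : Outcome nt nr T) : Matrix (Fin nr) (Fin nt) ℂ := Matrix.of ω.2.1

/-- The noise matrix. -/
def W (ω : Outcome nt nr T) : Matrix (Fin nr) (Fin T) ℂ := Matrix.of ω.2.2

/-- The received signal. -/
def Y (ω : Outcome nt nr T) : Matrix (Fin nr) (Fin T) ℂ := ω.H * ω.X + ω.W

end Outcome

/-- The law at SNR `ρ`: the codeword is uniform on the codebook, `H` and `W` have i.i.d.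
standard complex Gaussian entries, and the three are independent. -/
def channelLaw {nt T : ℕ} (nr : ℕ) (C : LDCode nt T) (ρ : ℝ) : Measure (Outcome nt nr T) :=
  (uniformOn {x : Fin nt → Fin T → ℂ | Matrix.of x ∈ C.codebook ρ}).prod
    ((gaussianArray nr nt).prod (gaussianArray nr T))

/-- `- log p / log ρ`, with values in the extended reals (it is `⊤` if `p = 0` and `1 < ρ`). -/
def snrExponent (p : ℝ≥0∞) (ρ : ℝ) : EReal :=
  -(ENNReal.log p / (Real.log ρ : EReal))

/-! ### Maximum-likelihood decoding and diversity gain -/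

/-- `dec ρ H Y` is a maximum-likelihood decision at SNR `ρ` for every channel matrix `H` and
received signal `Y` (ties are broken arbitrarily). -/
def IsMLDecoder {nt T nr : ℕ} (C : LDCode nt T)
    (dec : ℝ → Matrix (Fin nr) (Fin nt) ℂ → Matrix (Fin nr) (Fin T) ℂ →
      Matrix (Fin nt) (Fin T) ℂ) : Prop :=
  ∀ ρ H Y, dec ρ H Y ∈ C.codebook ρ ∧
    ∀ X ∈ C.codebook ρ, frobSq (Y - H * dec ρ H Y) ≤ frobSq (Y - H * X)

/-- The code has diversity gain `d` under the decoder `dec`. -/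
def HasDiversityGain {nt T nr : ℕ} (C : LDCode nt T)
    (dec : ℝ → Matrix (Fin nr) (Fin nt) ℂ → Matrix (Fin nr) (Fin T) ℂ →
      Matrix (Fin nt) (Fin T) ℂ) (d : ℝ) : Prop :=
  Tendsto (fun ρ : ℝ =>
      snrExponent (channelLaw nr C ρ {ω | dec ρ ω.H ω.Y ≠ ω.X}) ρ) atTop (𝓝 (d : EReal))

/-! ### The sphere decoder -/

/-- `M = Q R` is a thin QR-decomposition: `Q` has orthonormal columns and `R` is upper
triangular. -/
def IsThinQR {m : Type*} [Fintype m] {κ : ℕ} (M Q : Matrix m (Fin κ) ℂ)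
    (R : Matrix (Fin κ) (Fin κ) ℂ) : Prop :=
  Qᴴ * Q = 1 ∧ R.BlockTriangular id ∧ Q * R = M

/-- The position in `Fin κ` of the `i`-th of the last `k + 1` coordinates. -/
def lastIdx {κ : ℕ} (k : Fin κ) (i : Fin (k + 1)) : Fin κ :=
  ⟨κ - (k + 1) + i, by have := k.isLt; have := i.isLt; omega⟩

open Classical in
/-- The nodes visited at layer `k + 1`: the partial symbol vectors `ŝ` of length `k + 1` with
`‖rₖ₊₁ - Rₖ₊₁ ŝ‖² ≤ ξ²`, where `rₖ₊₁` holds the last `k + 1` entries of `r` and `Rₖ₊₁` is the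
lower right `(k + 1) × (k + 1)` corner of `R`. -/
def visitedNodes {κ : ℕ} (η ξ : ℝ) (r : Fin κ → ℂ) (R : Matrix (Fin κ) (Fin κ) ℂ) (k : Fin κ) :
    Finset (Fin (k + 1) → ℂ) :=
  (symbolVectors (k + 1) η).filter fun s =>
    sqNorm (r ∘ lastIdx k - (R.submatrix (lastIdx k) (lastIdx k)) *ᵥ s) ≤ ξ ^ 2

/-- The total number of nodes visited, over the layers `1, …, κ`. -/
def numVisitedNodes {κ : ℕ} (η ξ : ℝ) (r : Fin κ → ℂ) (R : Matrix (Fin κ) (Fin κ) ℂ) : ℕ :=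
  ∑ k : Fin κ, (visitedNodes η ξ r R k).card

/-- The number `N` of nodes visited by the sphere decoder of search radius `ξ ρ` which uses the
decomposition `Q ρ H`, `R ρ H` of the code-channel generator matrix, as a random variable;
here `r = Qᴴ vec(Y)`. -/
def sdNodes {nt T nr : ℕ} (C : LDCode nt T) (ξ : ℝ → ℝ)
    (Q : ℝ → Matrix (Fin nr) (Fin nt) ℂ → Matrix (Fin T × Fin nr) (Fin (nt * T)) ℂ)
    (R : ℝ → Matrix (Fin nr) (Fin nt) ℂ → Matrix (Fin (nt * T)) (Fin (nt * T)) ℂ)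
    (ρ : ℝ) (ω : Outcome nt nr T) : ℕ :=
  numVisitedNodes (C.eta ρ) (ξ ρ) ((Q ρ ω.H)ᴴ *ᵥ Matrix.vec ω.Y) (R ρ ω.H)

/-- `Ψ(x)`, the decay exponent of `P(N ≥ ρ ^ x)`. The lower limit agrees with the limit
whenever the latter exists. -/
def Psi {nt T nr : ℕ} (C : LDCode nt T) (ξ : ℝ → ℝ)
    (Q : ℝ → Matrix (Fin nr) (Fin nt) ℂ → Matrix (Fin T × Fin nr) (Fin (nt * T)) ℂ)
    (R : ℝ → Matrix (Fin nr) (Fin nt) ℂ → Matrix (Fin (nt * T)) (Fin (nt * T)) ℂ)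
    (x : ℝ) : EReal :=
  liminf (fun ρ : ℝ =>
    snrExponent (channelLaw nr C ρ {ω | ρ ^ x ≤ (sdNodes C ξ Q R ρ ω : ℝ)}) ρ) atTop

/-- The SD complexity exponent `inf {x | Ψ(x) > d}` (an infimum in the extended reals). -/
def sdComplexityExponent {nt T nr : ℕ} (C : LDCode nt T) (ξ : ℝ → ℝ)
    (Q : ℝ → Matrix (Fin nr) (Fin nt) ℂ → Matrix (Fin T × Fin nr) (Fin (nt * T)) ℂ)
    (R : ℝ → Matrix (Fin nr) (Fin nt) ℂ → Matrix (Fin (nt * T)) (Fin (nt * T)) ℂ)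
    (d : ℝ) : EReal :=
  sInf ((fun x : ℝ => (x : EReal)) '' {x : ℝ | (d : EReal) < Psi C ξ Q R x})

/-! ### The optimization problem -/

/-- The feasible singularity levels: `α₁ ≥ … ≥ α_{nt} ≥ 0` and
`∑ᵢ (nr - nt + 2 i - 1) αᵢ ≤ d`, the index `i` running from `1` to `nt`. -/
def feasibleLevels (nt nr : ℕ) (d : ℝ) : Set (Fin nt → ℝ) :=
  {α | Antitone α ∧ (∀ i, 0 ≤ α i) ∧
    ∑ i : Fin nt, ((nr : ℝ) - nt + 2 * ((i : ℝ) + 1) - 1) * α i ≤ d}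

/-- The objective `∑ᵢ T min(r / nt - 1 + αᵢ, r / nt)⁺`. -/
def objective (nt T : ℕ) (r : ℝ) (α : Fin nt → ℝ) : ℝ :=
  ∑ i : Fin nt, (T : ℝ) * max (min (r / nt - 1 + α i) (r / nt)) 0

end SphereDecoding

end

/-!
The number of visited nodes is controlled by the channel matrix `H` alone. The usual proof works
with the singular values of `H` and the joint density of the eigenvalues of a Wishart matrix. Here
the pivots `v₀ ≥ v₁ ≥ …` of Gaussian elimination with complete pivoting on `H` play the role of the
singular values; they carry the same information up to constant factors, and no density is needed.

*Nodes.* Two nodes of one layer differ by a vector `d` of Gaussian integers with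
`‖Rₖ d‖ ≤ 2 ξ` and entries `O(η)`. As `R` is triangular and, almost surely, invertible, `d` is the end of a vector
`u` with `‖R u‖ = ‖Rₖ d‖` (`exists_extend_lastIdx`), and `‖R u‖ = ‖θ (I ⊗ H) G u‖`. Elimination on `H`
confines `u`, hence `d`, to a linear image of a polydisc with radii `O(ξ / (θ vᵢ))`, each `T` times,
under a matrix of bounded size. Counting separated points there, with all radii cut off at `O(η)`
(`card_le_prod_of_truncated_linear_image`), gives `N ≤ κ ∏ᵢ (2 + K min (ξ / (θ vᵢ), L)) ^ (2 T)`
for `L = 2 ⌊η⌋ + 1` (`LDCode.exists_numVisitedNodes_le`). The multiplexing gain and the power constraint give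
`L ≤ ρ ^ (r / (2 nt) + o(1))` and `ξ / θ ≤ ρ ^ ((r / nt - 1) / 2 + o(1))`; with `vᵢ² = ρ ^ (-αᵢ)`
this is `N ≤ ρ ^ (∑ᵢ T min (r / nt - 1 + αᵢ, r / nt)⁺ + o(1))`.

*Probability.* The Gaussian law is dominated by Lebesgue measure. The pivot `k` (counted from `0`)
bounds the `nr + nt - 2 k - 1` entries in its row and column of the current Schur complement, and
the Schur complement is a translate of a minor of the array, by an amount depending on the row and
the column only. By Fubini's theorem, the arrays with pivots at most `δₖ` have volume
`O(∏ₖ δₖ ^ (2 (nr + nt - 2 k - 1)))` (`volume_pivotSet_le`), which for `δₖ² = ρ ^ (-αₖ)` is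
`ρ ^ (-∑ₖ (nr + nt - 2 k - 1) αₖ)`. Counting the pivots from the smallest one upwards turns the
coefficients into `nr - nt + 2 i - 1`.

*Conclusion.* Let `x` exceed the maximum of the optimization problem, and round the levels `αᵢ`,
truncated to `[0, 1]`, down to a fine grid. If `N ≥ ρ ^ x`, then the grid point has an objective
above the maximum, so it is infeasible and its exponent exceeds `d`. There are finitely many grid
points, so the exponents exceed `d` by a fixed amount, and `Ψ(x) > d` (`lt_Psi`).
-/

namespace SphereDecoding

/-! ### Domination of the Gaussian law by Lebesgue measure, and its tails -/

theorem _root_.MeasureTheory.Measure.pi_le_pi {ι : Type*} [Fintype ι] {α : ι → Type*}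
    [∀ i, MeasurableSpace (α i)] {μ ν : ∀ i, Measure (α i)} [∀ i, SigmaFinite (μ i)]
    [∀ i, SigmaFinite (ν i)] (h : ∀ i, μ i ≤ ν i) : Measure.pi μ ≤ Measure.pi ν := by
  have key : (Measure.pi μ).toOuterMeasure ≤ OuterMeasure.pi fun i => (ν i).toOuterMeasure := by
    rw [OuterMeasure.le_pi]
    intro s _
    change Measure.pi μ _ ≤ _
    rw [Measure.pi_pi]
    exact Finset.prod_le_prod' fun i _ => h i _
  refine Measure.le_iff.2 fun s hs => ?_
  rw [Measure.pi, Measure.pi] at *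
  rw [toMeasure_apply (OuterMeasure.pi fun i => (ν i).toOuterMeasure) _ hs]
  exact key s

instance : IsProbabilityMeasure complexGaussian := by
  unfold complexGaussian
  refine Measure.isProbabilityMeasure_map ?_
  exact (Complex.measurableEquivRealProd.symm.measurable).aemeasurable

instance (m n : ℕ) : IsProbabilityMeasure (gaussianArray m n) := by
  unfold gaussianArray; infer_instance

/-- The density is at most `1 / √π ≤ 1`. -/
theorem gaussianReal_half_le_volume : gaussianReal 0 (1 / 2) ≤ volume := by
  rw [gaussianReal_of_var_ne_zero _ (by norm_num)]
  conv_rhs => rw [← withDensity_one (μ := (volume : Measure ℝ))]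
  refine withDensity_mono (Eventually.of_forall fun x => ?_)
  rw [gaussianPDF, Pi.one_apply]
  refine ENNReal.ofReal_le_one.2 ?_
  rw [gaussianPDFReal]
  have h1 : Real.exp (-(x - 0) ^ 2 / (2 * ((1 / 2 : ℝ≥0) : ℝ))) ≤ 1 := by
    rw [Real.exp_le_one_iff]
    exact div_nonpos_of_nonpos_of_nonneg (by nlinarith [sq_nonneg (x - 0)]) (by positivity)
  have h2 : (√(2 * Real.pi * ((1 / 2 : ℝ≥0) : ℝ)))⁻¹ ≤ 1 := by
    refine inv_le_one_of_one_le₀ ?_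
    rw [Real.one_le_sqrt]
    push_cast
    nlinarith [Real.pi_gt_three]
  calc _ ≤ (1 : ℝ) * 1 := mul_le_mul h2 h1 (Real.exp_nonneg _) zero_le_one
    _ = 1 := one_mul 1

theorem complexGaussian_le_volume : complexGaussian ≤ volume := by
  have h : MeasurePreserving Complex.measurableEquivRealProd.symm :=
    Complex.volume_preserving_equiv_real_prod.symm _
  have h2 : complexGaussian = ((gaussianReal 0 (1 / 2)).prod (gaussianReal 0 (1 / 2))).map
    Complex.measurableEquivRealProd.symm := rfl
  rw [h2, ← h.map_eq]
  exact Measure.map_mono (Measure.prod_mono gaussianReal_half_le_volume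
    gaussianReal_half_le_volume) h.measurable

theorem gaussianArray_le_volume (m n : ℕ) : gaussianArray m n ≤ volume :=
  Measure.pi_le_pi fun _ => Measure.pi_le_pi fun _ => complexGaussian_le_volume

theorem gaussianReal_tail (p : ℕ) : ∃ c : ℝ, ∀ t : ℝ, 0 < t →
    gaussianReal 0 (1 / 2) {x | t ≤ |x|} ≤ ENNReal.ofReal (c / t ^ p) := by
  rcases Nat.eq_zero_or_pos p with rfl | hp
  · refine ⟨1, fun t _ => ?_⟩
    simpa using prob_le_one
  have hm := memLp_id_gaussianReal (μ := 0) (v := 1 / 2) (p : ℝ≥0)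
  set e := eLpNorm id ((p : ℝ≥0) : ℝ≥0∞) (gaussianReal 0 (1 / 2)) with he
  refine ⟨(e ^ p).toReal, fun t ht => ?_⟩
  have h := meas_ge_le_mul_pow_eLpNorm_enorm (gaussianReal 0 (1 / 2)) (p := ((p : ℝ≥0) : ℝ≥0∞))
    (by simpa using hp.ne') (by simp) hm.1 (ε := ENNReal.ofReal t) (by simpa using ht) (by simp)
  have hpr : ((p : ℝ≥0) : ℝ≥0∞).toReal = p := by simp
  rw [hpr, ENNReal.rpow_natCast, ENNReal.rpow_natCast, ← he] at h
  have hs : {x : ℝ | t ≤ |x|} ⊆ {x | ENNReal.ofReal t ≤ ‖id x‖ₑ} := by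
    intro x hx
    simp only [Set.mem_ofPred_eq, id, ← ofReal_norm, Real.norm_eq_abs] at hx ⊢
    exact ENNReal.ofReal_le_ofReal hx
  refine (measure_mono hs).trans (h.trans ?_)
  have htop : e ≠ ⊤ := hm.2.ne
  rw [ENNReal.ofReal_div_of_pos (by positivity), ENNReal.ofReal_toReal (ENNReal.pow_ne_top htop),
    ENNReal.ofReal_pow ht.le, ENNReal.div_eq_inv_mul, ENNReal.inv_pow]

theorem complexGaussian_tail (p : ℕ) : ∃ c : ℝ, 0 ≤ c ∧ ∀ t : ℝ, 0 < t →
    complexGaussian {z | t < ‖z‖} ≤ ENNReal.ofReal (c / t ^ p) := by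
  obtain ⟨c, hc⟩ := gaussianReal_tail p
  refine ⟨2 * (|c| * 2 ^ p), by positivity, fun t ht => ?_⟩
  have hmeas : Measurable fun p : ℝ × ℝ => (⟨p.1, p.2⟩ : ℂ) :=
    Complex.measurableEquivRealProd.symm.measurable
  have h2 : 0 < t / 2 := by positivity
  rw [complexGaussian, Measure.map_apply hmeas (measurableSet_lt measurable_const measurable_norm)]
  have hs : (fun p : ℝ × ℝ => (⟨p.1, p.2⟩ : ℂ)) ⁻¹' {z | t < ‖z‖} ⊆
      ({x | t / 2 ≤ |x|} ×ˢ Set.univ) ∪ (Set.univ ×ˢ {x | t / 2 ≤ |x|}) := by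
    rintro ⟨a, b⟩ h
    have h1 := Complex.norm_le_abs_re_add_abs_im ⟨a, b⟩
    simp only [Set.mem_preimage, Set.mem_ofPred_eq, Set.mem_union, Set.mem_prod, Set.mem_univ,
      and_true, true_and] at h h1 ⊢
    by_contra! hcon
    linarith [hcon.1, hcon.2]
  refine (measure_mono hs).trans ((measure_union_le _ _).trans ?_)
  rw [Measure.prod_prod, Measure.prod_prod, measure_univ, one_mul, mul_one, ← two_mul]
  refine (mul_le_mul_right (hc _ h2) 2).trans ?_
  rw [← ENNReal.ofReal_ofNat, ← ENNReal.ofReal_mul (by norm_num)]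
  refine ENNReal.ofReal_le_ofReal ?_
  rw [div_pow, div_div_eq_mul_div, mul_div_assoc]
  have hcc : c * 2 ^ p ≤ |c| * 2 ^ p := by
    gcongr
    exact le_abs_self c
  have htp : 0 < t ^ p := by positivity
  rw [← mul_div_assoc, ← mul_div_assoc]
  gcongr

theorem gaussianArray_tail (m n p : ℕ) : ∃ c : ℝ, ∀ t : ℝ, 0 < t →
    gaussianArray m n {H | ∃ i j, t < ‖H i j‖} ≤ ENNReal.ofReal (c / t ^ p) := by
  obtain ⟨c, hc0, hc⟩ := complexGaussian_tail p
  refine ⟨m * (n * c), fun t ht => ?_⟩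
  have hs : {H : Fin m → Fin n → ℂ | ∃ i j, t < ‖H i j‖} =
      ⋃ i, ⋃ j, (Function.eval i) ⁻¹' ((Function.eval j) ⁻¹' {z | t < ‖z‖}) := by
    ext H; simp
  have hm : MeasurableSet {z : ℂ | t < ‖z‖} := measurableSet_lt measurable_const measurable_norm
  have hone : ∀ i j, gaussianArray m n ((Function.eval i) ⁻¹' ((Function.eval j) ⁻¹' {z | t < ‖z‖}))
      = complexGaussian {z | t < ‖z‖} := by
    intro i j
    rw [gaussianArray, (measurePreserving_eval _ i).measure_preimage
      ((measurable_pi_apply j) hm).nullMeasurableSet,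
      (measurePreserving_eval _ j).measure_preimage hm.nullMeasurableSet]
  rw [hs]
  calc _ ≤ ∑ i : Fin m, ∑ j : Fin n, ENNReal.ofReal (c / t ^ p) := by
        refine (measure_iUnion_fintype_le _ _).trans (Finset.sum_le_sum fun i _ => ?_)
        refine (measure_iUnion_fintype_le _ _).trans (Finset.sum_le_sum fun j _ => ?_)
        rw [hone]
        exact hc t ht
    _ = _ := by
        simp only [Finset.sum_const, Finset.card_univ, Fintype.card_fin, nsmul_eq_mul]
        rw [mul_div_assoc, mul_div_assoc, ENNReal.ofReal_mul (by positivity),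
          ENNReal.ofReal_mul (by positivity), ENNReal.ofReal_natCast, ENNReal.ofReal_natCast]

/-! ### Gaussian elimination with complete pivoting: volume of the sets of small pivots -/

/-- The Schur complement of the entry `(p, q)` of `H`. -/
noncomputable def schurComplement {m n : ℕ} (p : Fin (m + 1)) (q : Fin (n + 1))
    (H : Fin (m + 1) → Fin (n + 1) → ℂ) : Fin m → Fin n → ℂ := fun i j =>
  H (p.succAbove i) (q.succAbove j) - H (p.succAbove i) q * H p (q.succAbove j) / H p q

/-- The arrays for which Gaussian elimination with some choice of pivots meets, in the row and
the column of the `k`-th pivot, only entries of absolute value at most `δ k`. -/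
def pivotSet : ∀ m n : ℕ, (Fin n → ℝ) → Set (Fin m → Fin n → ℂ)
  | _, 0, _ => Set.univ
  | 0, _ + 1, _ => Set.univ
  | m + 1, n + 1, δ => ⋃ p : Fin (m + 1), ⋃ q : Fin (n + 1),
      {H | (∀ j, ‖H p j‖ ≤ δ 0) ∧ (∀ i, ‖H (p.succAbove i) q‖ ≤ δ 0) ∧
        schurComplement p q H ∈ pivotSet m n fun k => δ k.succ}

theorem measurable_schurComplement {m n : ℕ} (p : Fin (m + 1)) (q : Fin (n + 1)) :
    Measurable (schurComplement p q) := by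
  unfold schurComplement
  fun_prop

theorem measurableSet_pivotSet : ∀ (m n : ℕ) (δ : Fin n → ℝ), MeasurableSet (pivotSet m n δ)
  | _, 0, _ => by simp [pivotSet]
  | 0, _ + 1, _ => by simp [pivotSet]
  | m + 1, n + 1, δ => by
    rw [pivotSet]
    refine MeasurableSet.iUnion fun p => MeasurableSet.iUnion fun q => ?_
    refine MeasurableSet.inter ?_ (MeasurableSet.inter ?_ ?_)
    · refine MeasurableSet.congr (s := ⋂ j, {H | ‖H p j‖ ≤ δ 0}) ?_ (by ext; simp; rfl)
      exact MeasurableSet.iInter fun j => measurableSet_le (by fun_prop) (by fun_prop)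
    · refine MeasurableSet.congr (s := ⋂ i, {H | ‖H (p.succAbove i) q‖ ≤ δ 0}) ?_ (by ext; simp; rfl)
      exact MeasurableSet.iInter fun j => measurableSet_le (by fun_prop) (by fun_prop)
    · exact measurable_schurComplement p q (measurableSet_pivotSet m n _)

theorem volume_polydisc (n : ℕ) (δ : ℝ) :
    volume {a : Fin n → ℂ | ∀ j, ‖a j‖ ≤ δ} = (ENNReal.ofReal δ ^ 2 * NNReal.pi) ^ n := by
  have : {a : Fin n → ℂ | ∀ j, ‖a j‖ ≤ δ} = Set.univ.pi fun _ => Metric.closedBall 0 δ := by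
    ext a; simp
  rw [this, volume_pi_pi]
  simp [Complex.volume_closedBall]

/-- Splits an array into the row `p`, the rest of the column `q`, and the remaining minor. -/
noncomputable def splitCross (m n : ℕ) (p : Fin (m + 1)) (q : Fin (n + 1)) :
    (Fin (m + 1) → Fin (n + 1) → ℂ) ≃ᵐ
      (Fin (n + 1) → ℂ) × (Fin m → ℂ) × (Fin m → Fin n → ℂ) :=
  (MeasurableEquiv.piFinSuccAbove (fun _ => Fin (n + 1) → ℂ) p).trans
    (MeasurableEquiv.prodCongr (MeasurableEquiv.refl _)
      ((MeasurableEquiv.piCongrRight fun _ : Fin m =>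
        MeasurableEquiv.piFinSuccAbove (fun _ : Fin (n + 1) => ℂ) q).trans
        (MeasurableEquiv.arrowProdEquivProdArrow ℂ (Fin n → ℂ) (Fin m))))

theorem volume_preserving_splitCross (m n : ℕ) (p : Fin (m + 1)) (q : Fin (n + 1)) :
    MeasurePreserving (splitCross m n p q) := by
  have h1 := volume_preserving_piFinSuccAbove (fun _ : Fin (m + 1) => Fin (n + 1) → ℂ) p
  have h2 := volume_preserving_piFinSuccAbove (fun _ : Fin (n + 1) => ℂ) q
  have h3 : MeasurePreserving (MeasurableEquiv.piCongrRight fun _ : Fin m =>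
        MeasurableEquiv.piFinSuccAbove (fun _ : Fin (n + 1) => ℂ) q) :=
    volume_preserving_pi fun _ => h2
  have h4 := volume_measurePreserving_arrowProdEquivProdArrow ℂ (Fin n → ℂ) (Fin m)
  exact ((MeasurePreserving.id volume).prod (h4.comp h3)).comp h1

theorem volume_cross_schurComplement_le {m n : ℕ} (p : Fin (m + 1)) (q : Fin (n + 1)) (δ : ℝ)
    {E : Set (Fin m → Fin n → ℂ)} (hE : MeasurableSet E) :
    volume {H : Fin (m + 1) → Fin (n + 1) → ℂ | (∀ j, ‖H p j‖ ≤ δ) ∧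
      (∀ i, ‖H (p.succAbove i) q‖ ≤ δ) ∧ schurComplement p q H ∈ E} ≤
    (ENNReal.ofReal δ ^ 2 * NNReal.pi) ^ (m + n + 1) * volume E := by
  -- The Schur complement is the minor translated by a function of the row and the column.
  let shift : (Fin (n + 1) → ℂ) × (Fin m → ℂ) → Fin m → Fin n → ℂ :=
    fun a i j => a.2 i * a.1 (q.succAbove j) / a.1 q
  let A : Set (Fin (n + 1) → ℂ) := {a | ∀ j, ‖a j‖ ≤ δ}
  let B : Set (Fin m → ℂ) := {b | ∀ i, ‖b i‖ ≤ δ}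
  let S : Set ((Fin (n + 1) → ℂ) × (Fin m → ℂ) × (Fin m → Fin n → ℂ)) :=
    {x | x.1 ∈ A ∧ x.2.1 ∈ B ∧ x.2.2 - shift (x.1, x.2.1) ∈ E}
  have hA : MeasurableSet A := by
    refine MeasurableSet.congr (s := ⋂ j, {a : Fin (n + 1) → ℂ | ‖a j‖ ≤ δ}) ?_
      (by ext; simp [A])
    exact MeasurableSet.iInter fun j => measurableSet_le (by fun_prop) (by fun_prop)
  have hB : MeasurableSet B := by
    refine MeasurableSet.congr (s := ⋂ j, {a : Fin m → ℂ | ‖a j‖ ≤ δ}) ?_ (by ext; simp [B])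
    exact MeasurableSet.iInter fun j => measurableSet_le (by fun_prop) (by fun_prop)
  have hS : MeasurableSet S := by
    refine (measurable_fst hA).inter (((measurable_fst.comp measurable_snd) hB).inter ?_)
    refine measurableSet_preimage (f := fun x : (Fin (n + 1) → ℂ) × (Fin m → ℂ) ×
      (Fin m → Fin n → ℂ) => x.2.2 - shift (x.1, x.2.1)) ?_ hE
    have : Measurable shift := by
      refine measurable_pi_lambda _ fun i => measurable_pi_lambda _ fun j => ?_
      fun_prop
    fun_prop
  have hpre : {H : Fin (m + 1) → Fin (n + 1) → ℂ | (∀ j, ‖H p j‖ ≤ δ) ∧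
      (∀ i, ‖H (p.succAbove i) q‖ ≤ δ) ∧ schurComplement p q H ∈ E} =
      splitCross m n p q ⁻¹' S := rfl
  rw [hpre, (volume_preserving_splitCross m n p q).measure_preimage hS.nullMeasurableSet,
    Measure.volume_eq_prod, Measure.prod_apply hS]
  have hfib : ∀ a, volume (Prod.mk a ⁻¹' S) ≤ A.indicator (fun _ => volume B * volume E) a := by
    intro a
    by_cases ha : a ∈ A
    · rw [Set.indicator_of_mem ha, Measure.volume_eq_prod,
        Measure.prod_apply (measurable_prodMk_left hS)]
      calc _ ≤ ∫⁻ b, B.indicator (fun _ => volume E) b := by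
            refine lintegral_mono fun b => ?_
            by_cases hb : b ∈ B
            · rw [Set.indicator_of_mem hb]
              refine (measure_mono (t := (fun x => x + -shift (a, b)) ⁻¹' E) ?_).trans
                (measure_preimage_add_right _ _ _).le
              intro x hx
              rw [Set.mem_preimage, ← sub_eq_add_neg]
              exact hx.2.2
            · rw [Set.indicator_of_notMem hb, nonpos_iff_eq_zero]
              convert measure_empty (μ := (volume : Measure (Fin m → Fin n → ℂ)))
              exact Set.eq_empty_of_forall_notMem fun x hx => hb hx.2.1
        _ = _ := by rw [lintegral_indicator_const hB, mul_comm]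
    · rw [Set.indicator_of_notMem ha, nonpos_iff_eq_zero]
      convert measure_empty (μ := (volume : Measure ((Fin m → ℂ) × (Fin m → Fin n → ℂ))))
      exact Set.eq_empty_of_forall_notMem fun x hx => ha hx.1
  calc _ ≤ ∫⁻ a, A.indicator (fun _ => volume B * volume E) a := lintegral_mono hfib
    _ = _ := by
      rw [lintegral_indicator_const hA, volume_polydisc, volume_polydisc]
      ring

theorem volume_pivotSet_le : ∀ m n : ℕ, n ≤ m → ∃ c : ℝ≥0∞, c ≠ ⊤ ∧ ∀ δ : Fin n → ℝ,
    volume (pivotSet m n δ) ≤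
      c * ∏ k : Fin n, ENNReal.ofReal (δ k) ^ (2 * (m + n - 2 * (k : ℕ) - 1))
  | m, 0, _ => ⟨1, ENNReal.one_ne_top, fun δ => by
    simp [pivotSet, volume_pi, Measure.pi_univ]⟩
  | m + 1, n + 1, h => by
    obtain ⟨c, hc, hle⟩ := volume_pivotSet_le m n (by omega)
    refine ⟨(m + 1 : ℕ) * ((n + 1 : ℕ) * ((NNReal.pi : ℝ≥0∞) ^ (m + n + 1) * c)), ?_,
      fun δ => ?_⟩
    · finiteness
    rw [pivotSet]
    set b := ∏ k : Fin (n + 1),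
      ENNReal.ofReal (δ k) ^ (2 * ((m + 1) + (n + 1) - 2 * (k : ℕ) - 1)) with hb
    have hone : ∀ (p : Fin (m + 1)) (q : Fin (n + 1)),
        volume {H : Fin (m + 1) → Fin (n + 1) → ℂ | (∀ j, ‖H p j‖ ≤ δ 0) ∧
          (∀ i, ‖H (p.succAbove i) q‖ ≤ δ 0) ∧
          schurComplement p q H ∈ pivotSet m n fun k => δ k.succ} ≤
        (NNReal.pi : ℝ≥0∞) ^ (m + n + 1) * c * b := by
      intro p q
      refine (volume_cross_schurComplement_le p q (δ 0) (measurableSet_pivotSet m n _)).trans ?_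
      refine (mul_le_mul_right (hle _) _).trans (le_of_eq ?_)
      rw [hb, Fin.prod_univ_succ, mul_pow, ← pow_mul]
      have e1 : 2 * (m + 1 + (n + 1) - 2 * ((0 : Fin (n + 1)) : ℕ) - 1) = 2 * (m + n + 1) := by
        simp; omega
      have e2 : ∀ k : Fin n, 2 * (m + 1 + (n + 1) - 2 * (k.succ : ℕ) - 1) =
          2 * (m + n - 2 * (k : ℕ) - 1) := by
        intro k; simp; omega
      rw [e1]
      simp only [e2]
      ring
    calc _ ≤ ∑ p : Fin (m + 1), ∑ q : Fin (n + 1), (NNReal.pi : ℝ≥0∞) ^ (m + n + 1) * c * b := by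
          refine (measure_iUnion_fintype_le _ _).trans (Finset.sum_le_sum fun p _ => ?_)
          refine (measure_iUnion_fintype_le _ _).trans (Finset.sum_le_sum fun q _ => ?_)
          exact hone p q
      _ = _ := by
          simp only [Finset.sum_const, Finset.card_univ, Fintype.card_fin, nsmul_eq_mul]
          ring

/-! ### Gaussian elimination with complete pivoting: solving `H z = w` -/

theorem zero_mem_pivotSet : ∀ (m n : ℕ) (δ : Fin n → ℝ), (∀ k, 0 ≤ δ k) →
    (0 : Fin m → Fin n → ℂ) ∈ pivotSet m n δ
  | _, 0, _, _ => by simp [pivotSet]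
  | 0, _ + 1, _, _ => by simp [pivotSet]
  | m + 1, n + 1, δ, h => by
    rw [pivotSet]
    refine Set.mem_iUnion.2 ⟨0, Set.mem_iUnion.2 ⟨0, ?_, ?_, ?_⟩⟩
    · simpa using h 0
    · intro i; simpa using h 0
    · have : schurComplement (0 : Fin (m + 1)) (0 : Fin (n + 1)) 0 = 0 := by
        ext i j; simp [schurComplement]
      rw [this]
      exact zero_mem_pivotSet m n _ fun k => h _

/-- The outcome of Gaussian elimination with complete pivoting on `H`. The numbers `v k` are the
absolute values of the pivots, scaled by `2 ^ (-k)` to make them nonincreasing: the largest entry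
grows by a factor of at most `2` in each elimination step. The matrix `P` is, up to a permutation,
the inverse of the unit upper triangular factor; its size is bounded independently of `H`, and it
turns a bound on `H z` into bounds on the separate coordinates of `y = P⁻¹ z`. -/
theorem exists_pivots (n : ℕ) : ∃ c : ℝ, 0 ≤ c ∧ ∀ m, n ≤ m → ∀ H : Fin m → Fin n → ℂ,
    ∃ v : Fin n → ℝ, Antitone v ∧ (∀ k, 0 ≤ v k) ∧
      (∀ K, (∀ i j, ‖H i j‖ ≤ K) → ∀ k, v k ≤ K) ∧
      (∀ δ : Fin n → ℝ, (∀ k, 2 ^ n * v k ≤ δ k) → H ∈ pivotSet m n δ) ∧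
      ∃ P : Fin n → Fin n → ℂ, (∀ i k, ‖P i k‖ ≤ c) ∧
        ∀ (z : Fin n → ℂ) (β : ℝ), 0 ≤ β → (∀ i, ‖∑ j, H i j * z j‖ ≤ β) →
          ∃ y : Fin n → ℂ, (∀ i, z i = ∑ k, P i k * y k) ∧ ∀ k, v k * ‖y k‖ ≤ c * β := by
  induction n with
  | zero =>
    exact ⟨0, le_rfl, fun m _ H => ⟨0, fun _ _ _ => le_rfl, fun _ => le_rfl,
      fun K _ k => k.elim0, fun δ _ => by simp [pivotSet], 0, fun i => i.elim0,
      fun z β _ _ => ⟨0, fun i => i.elim0, fun k => k.elim0⟩⟩⟩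
  | succ n ih =>
    obtain ⟨c, hc, ih⟩ := ih
    refine ⟨(n + 1) * c + 1, by positivity, fun m hm H => ?_⟩
    obtain ⟨m, rfl⟩ : ∃ m', m = m' + 1 := ⟨m - 1, by omega⟩
    obtain ⟨⟨p, q⟩, hpq⟩ := Finite.exists_max fun x : Fin (m + 1) × Fin (n + 1) => ‖H x.1 x.2‖
    have hmax : ∀ i j, ‖H i j‖ ≤ ‖H p q‖ := fun i j => hpq (i, j)
    have hc1 : 0 ≤ (n : ℝ) * c := by positivity
    by_cases h0 : H p q = 0
    · have hH : H = 0 := by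
        ext i j
        simpa [h0] using hmax i j
      refine ⟨0, fun _ _ _ => le_rfl, fun _ => le_rfl, fun K hK k => ?_, fun δ hδ => ?_,
        fun i k => if i = k then 1 else 0, fun i k => ?_, fun z β hβ _ => ⟨z, fun i => ?_,
          fun k => ?_⟩⟩
      · exact (norm_nonneg _).trans (hK p q)
      · rw [hH]
        exact zero_mem_pivotSet _ _ _ fun k => by simpa using hδ k
      · beta_reduce
        split_ifs
        · rw [norm_one]; linarith
        · rw [norm_zero]; positivity
      · simp
      · simp only [Pi.zero_apply, zero_mul]; positivity
    have hpos : 0 < ‖H p q‖ := norm_pos_iff.2 h0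
    have hratio : ∀ j, ‖H p j / H p q‖ ≤ 1 := fun j => by
      rw [norm_div, div_le_one hpos]; exact hmax p j
    have hratio' : ∀ i, ‖H i q / H p q‖ ≤ 1 := fun i => by
      rw [norm_div, div_le_one hpos]; exact hmax i q
    obtain ⟨v, hanti, hnn, hK, hmem, P, hP, hsolve⟩ := ih m (by omega) (schurComplement p q H)
    have hv : ∀ k, v k ≤ 2 * ‖H p q‖ := by
      refine hK _ fun i j => ?_
      rw [schurComplement, mul_div_assoc]
      refine (norm_sub_le _ _).trans ?_
      rw [norm_mul, two_mul]
      exact add_le_add (hmax _ _) ((mul_le_of_le_one_right (norm_nonneg _) (hratio _)).trans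
        (hmax _ _))
    have hv0 : ∀ k, (Fin.cons ‖H p q‖ fun k => v k / 2 : Fin (n + 1) → ℝ) k ≤ ‖H p q‖ := by
      intro k
      refine Fin.cases ?_ (fun k => ?_) k
      · simp
      · simp only [Fin.cons_succ]; linarith [hv k]
    refine ⟨Fin.cons ‖H p q‖ fun k => v k / 2, ?_, ?_, fun K hK k => (hv0 k).trans (hK _ _), ?_,
      fun i => (q.insertNth (Fin.cons 1 fun k => -∑ j, H p (q.succAbove j) / H p q * P j k)
        (fun i => Fin.cons 0 (P i)) : Fin (n + 1) → Fin (n + 1) → ℂ) i, ?_, ?_⟩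
    · intro k l
      refine Fin.cases (fun _ => hv0 l) (fun k => ?_) k
      refine Fin.cases (fun h => ?_) (fun l h => ?_) l
      · exact absurd h (by simp)
      · simp only [Fin.cons_succ]
        have := hanti (Fin.succ_le_succ_iff.1 h)
        linarith
    · intro k
      refine Fin.cases (by simp) (fun k => ?_) k
      simp only [Fin.cons_succ]
      linarith [hnn k]
    · intro δ hδ
      have h2 : (1 : ℝ) ≤ 2 ^ (n + 1) := one_le_pow₀ one_le_two
      have hδ0 : ‖H p q‖ ≤ δ 0 := by
        have := hδ 0
        simp only [Fin.cons_zero] at this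
        nlinarith
      rw [pivotSet]
      refine Set.mem_iUnion.2 ⟨p, Set.mem_iUnion.2 ⟨q, fun j => (hmax _ _).trans hδ0,
        fun i => (hmax _ _).trans hδ0, hmem _ fun k => ?_⟩⟩
      have := hδ k.succ
      simp only [Fin.cons_succ] at this
      rw [pow_succ] at this
      linarith
    · intro i k
      refine Fin.succAboveCases q ?_ (fun i => ?_) i
      · beta_reduce
        rw [Fin.insertNth_apply_same]
        refine Fin.cases ?_ (fun k => ?_) k
        · simp only [Fin.cons_zero, norm_one]; nlinarith
        · simp only [Fin.cons_succ, norm_neg]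
          calc _ ≤ ∑ j : Fin n, c := by
                refine norm_sum_le_of_le _ fun j _ => ?_
                rw [norm_mul]
                exact (mul_le_of_le_one_left (norm_nonneg _) (hratio _)).trans (hP _ _)
            _ ≤ _ := by simp; linarith
      · beta_reduce
        rw [Fin.insertNth_apply_succAbove]
        refine Fin.cases ?_ (fun k => ?_) k
        · simp only [Fin.cons_zero, norm_zero]; positivity
        · simp only [Fin.cons_succ]
          linarith [hP i k]
    · intro z β hβ hz
      set w : Fin (m + 1) → ℂ := fun i => ∑ j, H i j * z j with hw
      have hwexp : ∀ i, w i = H i q * z q + ∑ j, H i (q.succAbove j) * z (q.succAbove j) :=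
        fun i => Fin.sum_univ_succAbove _ q
      have hschur : ∀ i, ∑ j, schurComplement p q H i j * z (q.succAbove j) =
          w (p.succAbove i) - H (p.succAbove i) q / H p q * w p := by
        intro i
        rw [hwexp, hwexp p]
        simp only [schurComplement, sub_mul, Finset.sum_sub_distrib]
        have : ∑ j, H (p.succAbove i) q * H p (q.succAbove j) / H p q * z (q.succAbove j) =
            H (p.succAbove i) q / H p q * ∑ j, H p (q.succAbove j) * z (q.succAbove j) := by
          rw [Finset.mul_sum]
          exact Finset.sum_congr rfl fun j _ => by ring
        rw [this, mul_add, ← mul_assoc, div_mul_cancel₀ _ h0]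
        ring
      obtain ⟨y, hy, hyb⟩ := hsolve (fun j => z (q.succAbove j)) (2 * β) (by positivity) (by
        intro i
        rw [hschur]
        refine (norm_sub_le _ _).trans ?_
        rw [norm_mul, two_mul]
        exact add_le_add (hz _) ((mul_le_of_le_one_left (norm_nonneg _) (hratio' _)).trans
          (hz _)))
      refine ⟨Fin.cons (w p / H p q) y, fun i => ?_, fun k => ?_⟩
      · refine Fin.succAboveCases q ?_ (fun i => ?_) i
        · beta_reduce
          rw [Fin.insertNth_apply_same, Fin.sum_univ_succ]
          simp only [Fin.cons_zero, Fin.cons_succ, one_mul]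
          have : ∑ k, -(∑ j, H p (q.succAbove j) / H p q * P j k) * y k =
              -∑ j, H p (q.succAbove j) / H p q * z (q.succAbove j) := by
            simp only [neg_mul, Finset.sum_neg_distrib, Finset.sum_mul]
            rw [Finset.sum_comm]
            congr 1
            refine Finset.sum_congr rfl fun j _ => ?_
            rw [hy j, Finset.mul_sum]
            exact Finset.sum_congr rfl fun k _ => by ring
          rw [this, hwexp p, add_div, Finset.sum_div, mul_div_cancel_left₀ _ h0, add_assoc,
            ← sub_eq_add_neg, ← Finset.sum_sub_distrib]
          simp [div_mul_eq_mul_div]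
        · beta_reduce
          rw [Fin.insertNth_apply_succAbove, Fin.sum_univ_succ]
          simp only [Fin.cons_zero, Fin.cons_succ, zero_mul, zero_add]
          exact hy i
      · refine Fin.cases ?_ (fun k => ?_) k
        · simp only [Fin.cons_zero]
          rw [norm_div, mul_div_cancel₀ _ hpos.ne']
          have := hz p
          nlinarith
        · simp only [Fin.cons_succ]
          have := hyb k
          nlinarith

/-! ### Counting separated points in a truncated linear image of a polydisc -/

/-- A cell of side `1 / (2 (K + 1))` of the polydisc is mapped to a set of diameter less than `1`,
so that it accounts for at most one point of `S`. -/
theorem card_le_prod_of_linear_image {ι κ : Type*} [Fintype ι] [Fintype κ] (A : κ → ι → ℂ)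
    {K : ℝ} (hK : 0 ≤ K) (hA : ∀ l, ∑ i, ‖A l i‖ ≤ K) (b : ι → ℝ) (hb : ∀ i, 0 ≤ b i)
    (S : Finset (κ → ℂ)) (hsep : ∀ s ∈ S, ∀ s' ∈ S, s ≠ s' → ∃ l, 1 ≤ ‖s l - s' l‖)
    (hS : ∀ d ∈ S, ∃ y : ι → ℂ, (∀ l, d l = ∑ i, A l i * y i) ∧ ∀ i, ‖y i‖ ≤ b i) :
    (S.card : ℝ) ≤ ∏ i, (2 + 4 * (K + 1) * b i) ^ 2 := by
  classical
  choose! y hy hyb using hS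
  set c : ℝ := 2 * (K + 1) with hc
  have hc0 : 0 < c := by positivity
  -- The cell of side `1 / c` containing `y d` determines `d`.
  let f : (κ → ℂ) → ι → ℤ × ℤ := fun d i => (⌊c * (y d i).re⌋, ⌊c * (y d i).im⌋)
  let I : ι → Finset ℤ := fun i => Finset.Icc (-⌊c * b i⌋ - 1) ⌊c * b i⌋
  have hfl : ∀ x M : ℝ, |x| ≤ M → -⌊M⌋ - 1 ≤ ⌊x⌋ ∧ ⌊x⌋ ≤ ⌊M⌋ := by
    intro x M h
    obtain ⟨h1, h2⟩ := abs_le.1 h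
    refine ⟨Int.le_floor.2 ?_, Int.floor_le_floor h2⟩
    push_cast
    linarith [Int.lt_floor_add_one M]
  have hmaps : ∀ d ∈ S, f d ∈ Fintype.piFinset fun i => I i ×ˢ I i := by
    intro d hd
    refine Fintype.mem_piFinset.2 fun i => Finset.mem_product.2 ⟨?_, ?_⟩
    all_goals
      refine Finset.mem_Icc.2 (hfl _ _ ?_)
      rw [abs_mul, abs_of_pos hc0]
      refine mul_le_mul_of_nonneg_left (le_trans ?_ (hyb d hd i)) hc0.le
    · exact Complex.abs_re_le_norm _
    · exact Complex.abs_im_le_norm _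
  have hinj : Set.InjOn f S := by
    intro d hd d' hd' h
    by_contra hne
    obtain ⟨l, hl⟩ := hsep d hd d' hd' hne
    have hclose : ∀ i, ‖y d i - y d' i‖ ≤ 1 / (K + 1) := by
      intro i
      have hi := congrFun h i
      have h1 := Int.abs_sub_lt_one_of_floor_eq_floor (congrArg Prod.fst hi)
      have h2 := Int.abs_sub_lt_one_of_floor_eq_floor (congrArg Prod.snd hi)
      rw [← mul_sub, abs_mul, abs_of_pos hc0] at h1 h2
      have h3 := Complex.norm_le_abs_re_add_abs_im (y d i - y d' i)
      rw [Complex.sub_re, Complex.sub_im] at h3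
      rw [le_div_iff₀ (by positivity)]
      nlinarith
    have : ‖d l - d' l‖ ≤ K * (1 / (K + 1)) := by
      rw [hy d hd l, hy d' hd' l, ← Finset.sum_sub_distrib]
      refine (norm_sum_le _ _).trans ?_
      calc _ ≤ ∑ i, ‖A l i‖ * (1 / (K + 1)) := by
            refine Finset.sum_le_sum fun i _ => ?_
            rw [← mul_sub, norm_mul]
            exact mul_le_mul_of_nonneg_left (hclose i) (norm_nonneg _)
        _ ≤ _ := by
            rw [← Finset.sum_mul]
            exact mul_le_mul_of_nonneg_right (hA l) (by positivity)
    have hlt : K * (1 / (K + 1)) < 1 := by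
      rw [mul_one_div, div_lt_one (by positivity)]; linarith
    linarith
  have hcard := Finset.card_le_card_of_injOn f hmaps hinj
  rw [Fintype.card_piFinset] at hcard
  calc (S.card : ℝ) ≤ ((∏ i, (I i ×ˢ I i).card : ℕ) : ℝ) := by exact_mod_cast hcard
    _ = ∏ i, ((I i).card : ℝ) ^ 2 := by
        push_cast
        exact Finset.prod_congr rfl fun i _ => by rw [Finset.card_product]; push_cast; ring
    _ ≤ _ := by
        refine Finset.prod_le_prod (fun i _ => by positivity) fun i _ => ?_
        refine pow_le_pow_left₀ (by positivity) ?_ 2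
        have h0 : 0 ≤ ⌊c * b i⌋ := Int.floor_nonneg.2 (mul_nonneg hc0.le (hb i))
        have hI : ((I i).card : ℤ) = 2 * ⌊c * b i⌋ + 2 := by
          simp only [I, Int.card_Icc]
          rw [Int.toNat_of_nonneg (by omega)]
          ring
        have hI' : ((I i).card : ℝ) = 2 * (⌊c * b i⌋ : ℝ) + 2 := by exact_mod_cast hI
        rw [hI']
        have := Int.floor_le (c * b i)
        rw [hc] at this ⊢
        linarith

/-- The constant in `card_le_prod_of_truncated_linear_image`, for a matrix with `a` columns, `b`
rows, and row sums of absolute values at most `K`. -/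
noncomputable def truncationConst (a b : ℕ) (K : ℝ) : ℝ :=
  4 * (K + a + 1) * ((b + 1) * (1 + K))

/-- If all points have norm at most `L`, then every polyradius `B i` may be replaced by
`min (B i) L`, with a constant that depends on `A` only through a bound for its size: the columns
of `A` with `L < B i` are replaced by an orthonormal basis of their span. -/
theorem card_le_prod_of_truncated_linear_image {ι κ : Type*} [Fintype ι] [Fintype κ]
    (A : κ → ι → ℂ) {K : ℝ} (hK : 0 ≤ K) (hA : ∀ l, ∑ i, ‖A l i‖ ≤ K) (B : ι → ℝ)
    (hB : ∀ i, 0 ≤ B i) {L : ℝ} (hL : 0 ≤ L)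
    (S : Finset (κ → ℂ)) (hsep : ∀ s ∈ S, ∀ s' ∈ S, s ≠ s' → ∃ l, 1 ≤ ‖s l - s' l‖)
    (hSL : ∀ d ∈ S, ∀ l, ‖d l‖ ≤ L)
    (hS : ∀ d ∈ S, ∃ y : ι → ℂ, (∀ l, d l = ∑ i, A l i * y i) ∧ ∀ i, ‖y i‖ ≤ B i) :
    (S.card : ℝ) ≤
      ∏ i, (2 + truncationConst (Fintype.card ι) (Fintype.card κ) K * min (B i) L) ^ 2 := by
  classical
  let col : {i // L < B i} → EuclideanSpace ℂ κ := fun i => WithLp.toLp 2 fun l => A l i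
  let V := Submodule.span ℂ (Set.range col)
  let e := stdOrthonormalBasis ℂ V
  have hrank : Module.finrank ℂ V ≤ Fintype.card {i // L < B i} := finrank_range_le_card col
  have hrank' : Module.finrank ℂ V ≤ Fintype.card ι :=
    hrank.trans (Fintype.card_subtype_le _)
  have hnorm : ∀ w : EuclideanSpace ℂ κ, ‖w‖ ≤ ∑ l, ‖w l‖ := fun w => by
    rw [EuclideanSpace.norm_eq]
    refine Real.sqrt_le_iff.2 ⟨Finset.sum_nonneg fun _ _ => norm_nonneg _, ?_⟩
    exact Finset.sum_sq_le_sq_sum_of_nonneg fun _ _ => norm_nonneg _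
  let A' : κ → ({i // ¬ L < B i} ⊕ Fin (Module.finrank ℂ V)) → ℂ := fun l =>
    Sum.elim (fun i => A l i) fun j => (e j : EuclideanSpace ℂ κ) l
  let b : ({i // ¬ L < B i} ⊕ Fin (Module.finrank ℂ V)) → ℝ :=
    Sum.elim (fun i => B i) fun _ => (Fintype.card κ + 1) * ((1 + K) * L)
  have hsub : ∀ l (g : ι → ℝ), (∀ i, 0 ≤ g i) → ∑ i : {i // ¬ L < B i}, ‖A l i‖ * g i ≤
      ∑ i, ‖A l i‖ * g i := by
    intro l g hg
    rw [← Fintype.sum_subtype_add_sum_subtype (fun i => L < B i) fun i => ‖A l i‖ * g i]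
    exact le_add_of_nonneg_left
      (Finset.sum_nonneg fun i _ => mul_nonneg (norm_nonneg _) (hg _))
  have h := card_le_prod_of_linear_image A' (K := K + Fintype.card ι) (by positivity) ?_ b ?_ S
    hsep ?_
  · refine h.trans ?_
    rw [Fintype.prod_sum_type]
    set C := truncationConst (Fintype.card ι) (Fintype.card κ) K with hC
    have hC0 : 0 ≤ C := by rw [hC, truncationConst]; positivity
    have hC1 : 4 * (K + Fintype.card ι + 1) ≤ C := by
      rw [hC, truncationConst]
      refine le_mul_of_one_le_right (by positivity) ?_
      have : (0 : ℝ) ≤ Fintype.card κ := Nat.cast_nonneg _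
      nlinarith
    rw [← Fintype.prod_subtype_mul_prod_subtype (fun i => L < B i), mul_comm]
    refine mul_le_mul ?_ ?_ (Finset.prod_nonneg fun _ _ => sq_nonneg _)
      (Finset.prod_nonneg fun _ _ => sq_nonneg _)
    · have h2 : ∀ i : {i // L < B i}, min (B i) L = L := fun i => min_eq_right i.2.le
      simp only [b, Sum.elim_inr, h2, Finset.prod_const, Finset.card_univ, Fintype.card_fin]
      have h3 : 4 * (K + Fintype.card ι + 1) * ((Fintype.card κ + 1) * ((1 + K) * L)) = C * L := by
        rw [hC, truncationConst]; ring
      rw [h3]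
      refine pow_le_pow_right₀ (one_le_pow₀ ?_) hrank
      nlinarith [mul_nonneg hC0 hL]
    · refine Finset.prod_le_prod (fun _ _ => sq_nonneg _) fun i _ => ?_
      have h2 : min (B i) L = B i := min_eq_left (not_lt.1 i.2)
      simp only [b, Sum.elim_inl, h2]
      have := hB i
      gcongr
  · intro l
    rw [Fintype.sum_sum_type]
    refine add_le_add ?_ ?_
    · have := hsub l (fun _ => 1) fun _ => zero_le_one
      simp only [mul_one] at this
      exact this.trans (hA l)
    · calc _ ≤ ∑ j : Fin (Module.finrank ℂ V), (1 : ℝ) := by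
            refine Finset.sum_le_sum fun j _ => ?_
            refine (PiLp.norm_apply_le (e j : EuclideanSpace ℂ κ) l).trans ?_
            exact (e.orthonormal.1 j).le
        _ ≤ _ := by simpa using hrank'
  · rintro (i | j)
    · exact hB i
    · simp only [b, Sum.elim_inr]; positivity
  · intro d hd
    obtain ⟨y, hy, hyb⟩ := hS d hd
    let w : EuclideanSpace ℂ κ := ∑ i : {i // L < B i}, y i • col i
    have hwV : w ∈ V := Submodule.sum_mem _ fun i _ =>
      Submodule.smul_mem _ _ (Submodule.subset_span ⟨i, rfl⟩)
    have hwl : ∀ l, w l = ∑ i : {i // L < B i}, A l i * y i := fun l => by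
      simp only [w, col, WithLp.ofLp_sum, WithLp.ofLp_smul, Finset.sum_apply, Pi.smul_apply,
        smul_eq_mul]
      exact Finset.sum_congr rfl fun i _ => mul_comm _ _
    have hsplit : ∀ l, d l = w l + ∑ i : {i // ¬ L < B i}, A l i * y i := fun l => by
      rw [hy, hwl, Fintype.sum_subtype_add_sum_subtype (fun i => L < B i) fun i => A l i * y i]
    have hwb : ‖w‖ ≤ (Fintype.card κ + 1) * ((1 + K) * L) := by
      have hone : ∀ l, ‖w l‖ ≤ (1 + K) * L := by
        intro l
        rw [eq_sub_of_add_eq (hsplit l).symm, add_mul, one_mul]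
        refine (norm_sub_le _ _).trans (add_le_add (hSL d hd l) ?_)
        calc _ ≤ ∑ i : {i // ¬ L < B i}, ‖A l i‖ * L := by
              refine norm_sum_le_of_le _ fun i _ => ?_
              rw [norm_mul]
              exact mul_le_mul_of_nonneg_left ((hyb i).trans (not_lt.1 i.2)) (norm_nonneg _)
          _ ≤ ∑ i, ‖A l i‖ * L := hsub l (fun _ => L) fun _ => hL
          _ ≤ _ := by
              rw [← Finset.sum_mul]
              exact mul_le_mul_of_nonneg_right (hA l) hL
      calc ‖w‖ ≤ ∑ l : κ, (1 + K) * L := (hnorm w).trans (Finset.sum_le_sum fun l _ => hone l)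
        _ = Fintype.card κ * ((1 + K) * L) := by simp
        _ ≤ _ := by gcongr; linarith
    refine ⟨Sum.elim (fun i => y i) fun j => inner ℂ (e j) ⟨w, hwV⟩, fun l => ?_, ?_⟩
    · rw [hsplit, Fintype.sum_sum_type, add_comm]
      congr 1
      have h1 := congrArg (fun x : V => (x : EuclideanSpace ℂ κ) l) (e.sum_repr' ⟨w, hwV⟩)
      simp only [Submodule.coe_sum, Submodule.coe_smul, WithLp.ofLp_sum, WithLp.ofLp_smul,
        Finset.sum_apply, Pi.smul_apply, smul_eq_mul] at h1
      rw [← h1]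
      exact Finset.sum_congr rfl fun j _ => mul_comm _ _
    · rintro (i | j)
      · exact hyb i
      · refine le_trans ?_ hwb
        refine (norm_inner_le_norm (𝕜 := ℂ) (e j) ⟨w, hwV⟩).trans ?_
        rw [e.orthonormal.1 j, one_mul]
        rfl

/-! ### The number of visited nodes for a given channel matrix -/

theorem sqNorm_sub_le {ι : Type*} [Fintype ι] {a b : ι → ℂ} {x : ℝ} (ha : sqNorm a ≤ x ^ 2)
    (hb : sqNorm b ≤ x ^ 2) : sqNorm (a - b) ≤ (2 * x) ^ 2 := by
  have h : sqNorm (a - b) ≤ 2 * sqNorm a + 2 * sqNorm b := by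
    unfold sqNorm
    rw [Finset.mul_sum, Finset.mul_sum, ← Finset.sum_add_distrib]
    refine Finset.sum_le_sum fun i _ => ?_
    have h1 := norm_sub_le (a i) (b i)
    have h2 := norm_nonneg (a i - b i)
    rw [Pi.sub_apply]
    nlinarith [sq_nonneg (‖a i‖ - ‖b i‖)]
  linarith

theorem norm_le_of_sqNorm_le {ι : Type*} [Fintype ι] {a : ι → ℂ} {x : ℝ} (hx : 0 ≤ x)
    (ha : sqNorm a ≤ x ^ 2) (i : ι) : ‖a i‖ ≤ x := by
  refine (pow_le_pow_iff_left₀ (norm_nonneg _) hx two_ne_zero).1 (le_trans ?_ ha)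
  exact Finset.single_le_sum (f := fun i => ‖a i‖ ^ 2) (fun _ _ => sq_nonneg _)
    (Finset.mem_univ i)

theorem sqNorm_eq_dotProduct {ι : Type*} [Fintype ι] (a : ι → ℂ) :
    ((sqNorm a : ℝ) : ℂ) = star a ⬝ᵥ a := by
  simp [sqNorm, dotProduct, Complex.conj_mul']

theorem IsThinQR.sqNorm_mulVec {m : Type*} [Fintype m] {κ : ℕ} {M Q : Matrix m (Fin κ) ℂ}
    {R : Matrix (Fin κ) (Fin κ) ℂ} (h : IsThinQR M Q R) (u : Fin κ → ℂ) :
    sqNorm (M *ᵥ u) = sqNorm (R *ᵥ u) := by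
  have h2 : ∀ x : Fin κ → ℂ, sqNorm (Q *ᵥ x) = sqNorm x := by
    intro x
    have : ((sqNorm (Q *ᵥ x) : ℝ) : ℂ) = (sqNorm x : ℝ) := by
      rw [sqNorm_eq_dotProduct, sqNorm_eq_dotProduct, Matrix.star_mulVec,
        Matrix.dotProduct_mulVec, Matrix.vecMul_vecMul, h.1, Matrix.vecMul_one]
    exact_mod_cast this
  rw [← h.2.2, ← Matrix.mulVec_mulVec, h2]

theorem lastIdx_strictMono {κ : ℕ} (k : Fin κ) : StrictMono (lastIdx k) := by
  intro i j h
  simp only [lastIdx, Fin.mk_lt_mk]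
  omega

theorem lt_lastIdx_of_notMem_range {κ : ℕ} {k j : Fin κ} (h : j ∉ Set.range (lastIdx k))
    (i : Fin (k + 1)) : j < lastIdx k i := by
  by_contra hlt
  refine h ⟨⟨j - (κ - (k + 1)), ?_⟩, ?_⟩
  · have := j.isLt; have := k.isLt; omega
  · have h1 : (lastIdx k i : ℕ) ≤ j := not_lt.1 hlt
    simp only [lastIdx] at h1
    refine Fin.ext ?_
    simp only [lastIdx]
    omega

/-- A vector `d` of the last coordinates can be completed to a full vector `u` without increasing
the norm of the image under an invertible upper triangular matrix. -/
theorem exists_extend_lastIdx {κ : ℕ} {R : Matrix (Fin κ) (Fin κ) ℂ}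
    (hR : R.BlockTriangular id) (hdet : R.det ≠ 0) (k : Fin κ) (d : Fin (k + 1) → ℂ) :
    ∃ u : Fin κ → ℂ, (∀ i, u (lastIdx k i) = d i) ∧
      sqNorm (R *ᵥ u) = sqNorm (R.submatrix (lastIdx k) (lastIdx k) *ᵥ d) := by
  set Rk := R.submatrix (lastIdx k) (lastIdx k) with hRk
  have hinj := (lastIdx_strictMono k).injective
  have hRkt : Rk.BlockTriangular id := fun i j hij => hR (lastIdx_strictMono k hij)
  have hRkdet : Rk.det ≠ 0 := by
    rw [Matrix.det_of_isUpperTriangular hRkt]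
    rw [Matrix.det_of_isUpperTriangular hR] at hdet
    exact Finset.prod_ne_zero_iff.2 fun i _ =>
      Finset.prod_ne_zero_iff.1 hdet _ (Finset.mem_univ _)
  set w : Fin κ → ℂ := Function.extend (lastIdx k) (Rk *ᵥ d) 0 with hw
  have hwk : ∀ i, w (lastIdx k i) = (Rk *ᵥ d) i := fun i => hinj.extend_apply _ _ _
  have hRu : R *ᵥ (R⁻¹ *ᵥ w) = w := by
    rw [Matrix.mulVec_mulVec, Matrix.mul_nonsing_inv _ (isUnit_iff_ne_zero.2 hdet),
      Matrix.one_mulVec]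
  refine ⟨R⁻¹ *ᵥ w, ?_, ?_⟩
  · set u := R⁻¹ *ᵥ w
    have hz : Rk *ᵥ ((fun i => u (lastIdx k i)) - d) = 0 := by
      rw [Matrix.mulVec_sub, sub_eq_zero]
      ext i
      rw [← hwk, ← hRu]
      refine Fintype.sum_of_injective (lastIdx k) hinj _ _ (fun j hj => ?_) fun j => rfl
      exact mul_eq_zero_of_left (hR (lt_lastIdx_of_notMem_range hj i)) _
    have := Matrix.eq_zero_of_mulVec_eq_zero hRkdet hz
    exact fun i => sub_eq_zero.1 (congrFun this i)
  · rw [hRu]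
    refine (Fintype.sum_of_injective (lastIdx k) hinj _ _ (fun j hj => ?_) fun j => ?_).symm
    · rw [hw, Function.extend_apply' _ _ _ fun ⟨i, hi⟩ => hj ⟨i, hi⟩]
      simp
    · rw [hwk]

theorem norm_sub_le_of_mem_constellation {η : ℝ} {s s' : ℂ} (hs : s ∈ constellation η)
    (hs' : s' ∈ constellation η) : ‖s - s'‖ ≤ 4 * η := by
  obtain ⟨a, b, ha, hb, h1, h2⟩ := mem_constellation.1 hs
  obtain ⟨a', b', ha', hb', h1', h2'⟩ := mem_constellation.1 hs'
  refine (Complex.norm_le_abs_re_add_abs_im _).trans ?_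
  rw [Complex.sub_re, Complex.sub_im, h1, h2, h1', h2']
  have := abs_sub (a : ℝ) a'
  have := abs_sub (b : ℝ) b'
  linarith

theorem one_le_norm_sub_of_mem_constellation {η : ℝ} {s s' : ℂ} (hs : s ∈ constellation η)
    (hs' : s' ∈ constellation η) (hne : s ≠ s') : 1 ≤ ‖s - s'‖ := by
  obtain ⟨a, b, -, -, h1, h2⟩ := mem_constellation.1 hs
  obtain ⟨a', b', -, -, h1', h2'⟩ := mem_constellation.1 hs'
  by_cases hre : a = a'
  · have him : b ≠ b' := fun h => hne (Complex.ext (by rw [h1, h1', hre]) (by rw [h2, h2', h]))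
    refine le_trans ?_ (Complex.abs_im_le_norm _)
    rw [Complex.sub_im, h2, h2', ← Int.cast_sub, ← Int.cast_abs]
    exact_mod_cast Int.one_le_abs (sub_ne_zero.2 him)
  · refine le_trans ?_ (Complex.abs_re_le_norm _)
    rw [Complex.sub_re, h1, h1', ← Int.cast_sub, ← Int.cast_abs]
    exact_mod_cast Int.one_le_abs (sub_ne_zero.2 hre)

namespace LDCode

variable {nt T : ℕ} (C : LDCode nt T)

theorem exists_leftInverse_generator :
    ∃ G' : Matrix (Fin (nt * T)) (Fin T × Fin nt) ℂ, G' * C.generator = 1 := by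
  have hinj : Function.Injective (Matrix.toLin' C.generator) := by
    intro x x' h
    have h0 : ∑ i, (x i - x' i) • C.dispersion i = 0 := by
      ext a b
      have := congrFun h (b, a)
      simp only [Matrix.toLin'_apply, Matrix.mulVec, dotProduct, generator, Matrix.of_apply,
        Matrix.vec] at this
      simp only [Matrix.sum_apply, Matrix.smul_apply, smul_eq_mul, sub_mul,
        Finset.sum_sub_distrib, Matrix.zero_apply, sub_eq_zero]
      simpa only [mul_comm] using this
    ext i
    exact sub_eq_zero.1 (Fintype.linearIndependent_iff.1 C.linearIndependent _ h0 i)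
  obtain ⟨g, hg⟩ := LinearMap.exists_leftInverse_of_injective _ (LinearMap.ker_eq_bot.2 hinj)
  refine ⟨LinearMap.toMatrix' g, ?_⟩
  have := congrArg LinearMap.toMatrix' hg
  rwa [LinearMap.toMatrix'_comp, LinearMap.toMatrix'_toLin', LinearMap.toMatrix'_id] at this

theorem codeChannel_mulVec {nr : ℕ} (ρ : ℝ) (H : Matrix (Fin nr) (Fin nt) ℂ)
    (u : Fin (nt * T) → ℂ) (t : Fin T) (i : Fin nr) :
    (C.codeChannel ρ H *ᵥ u) (t, i) =
      C.theta ρ * ∑ j, H i j * (C.generator *ᵥ u) (t, j) := by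
  rw [codeChannel, Matrix.smul_mulVec, ← Matrix.mulVec_mulVec]
  rw [Pi.smul_apply, smul_eq_mul]
  congr 1
  rw [Matrix.mulVec, dotProduct, Fintype.sum_prod_type]
  simp [Matrix.one_apply]

/-- The number of integers in `[-η, η]`. -/
noncomputable def alphabetSize (ρ : ℝ) : ℝ := 2 * (⌊C.eta ρ⌋ : ℝ) + 1

theorem one_le_alphabetSize (ρ : ℝ) : 1 ≤ C.alphabetSize ρ := by
  have : (0 : ℝ) ≤ ⌊C.eta ρ⌋ := by exact_mod_cast Int.floor_nonneg.2 (C.eta_pos ρ).le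
  rw [alphabetSize]; linarith

theorem eta_le_alphabetSize (ρ : ℝ) : C.eta ρ ≤ C.alphabetSize ρ := by
  have : (0 : ℝ) ≤ ⌊C.eta ρ⌋ := by exact_mod_cast Int.floor_nonneg.2 (C.eta_pos ρ).le
  have := Int.lt_floor_add_one (C.eta ρ)
  rw [alphabetSize]; linarith

/-- The bound for the number of nodes: lattice points in an ellipsoid whose semi-axes are
comparable to `ξ / (θ v i)`, each repeated `T` times, intersected with a cube of side comparable
to `η`. The conditions on `v` and `P` are those provided by `exists_pivots`. -/
theorem exists_numVisitedNodes_le {c : ℝ} (hc : 0 ≤ c) : ∃ K : ℝ, 0 ≤ K ∧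
    ∀ {nr : ℕ} (ρ : ℝ) (H : Matrix (Fin nr) (Fin nt) ℂ)
      (Q : Matrix (Fin T × Fin nr) (Fin (nt * T)) ℂ)
      (R : Matrix (Fin (nt * T)) (Fin (nt * T)) ℂ), IsThinQR (C.codeChannel ρ H) Q R →
      ∀ v : Fin nt → ℝ, (∀ i, 0 < v i) → ∀ P : Fin nt → Fin nt → ℂ, (∀ i k, ‖P i k‖ ≤ c) →
      (∀ (z : Fin nt → ℂ) (β : ℝ), 0 ≤ β → (∀ i, ‖∑ j, H i j * z j‖ ≤ β) →
        ∃ y : Fin nt → ℂ, (∀ i, z i = ∑ k, P i k * y k) ∧ ∀ k, v k * ‖y k‖ ≤ c * β) →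
      ∀ (ξ : ℝ) (x : Fin (nt * T) → ℂ), 0 < ξ →
        (numVisitedNodes (C.eta ρ) ξ x R : ℝ) ≤ (nt * T : ℕ) *
          ∏ i, (2 + K * min (ξ / (C.theta ρ * v i)) (C.alphabetSize ρ)) ^ (2 * T) := by
  classical
  obtain ⟨G', hG'⟩ := C.exists_leftInverse_generator
  set g : ℝ := ∑ l, ∑ p, ‖G' l p‖ with hg
  have hg0 : 0 ≤ g := Finset.sum_nonneg fun _ _ => Finset.sum_nonneg fun _ _ => norm_nonneg _
  -- The matrices `A` below have row sums at most `K₀`.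
  set K₀ : ℝ := (T * nt : ℕ) * (g * c) with hK₀
  have hK₀0 : 0 ≤ K₀ := by positivity
  have hconst : ∀ b, 0 ≤ truncationConst (T * nt) b K₀ := fun b => by
    rw [truncationConst]; positivity
  set C₀ : ℝ := truncationConst (T * nt) (nt * T) K₀ with hC₀
  have hC₀0 : 0 ≤ C₀ := hconst _
  refine ⟨C₀ * (2 * c + 4), by positivity, ?_⟩
  intro nr ρ H Q R hQR v hv P hP hsolve ξ x hξ
  have hθ := C.theta_pos ρ
  set L := C.alphabetSize ρ with hL
  have hL1 : 1 ≤ L := C.one_le_alphabetSize ρ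
  -- A bound on `M u` confines `u` to a linear image of a polydisc.
  have hconf : ∀ (u : Fin (nt * T) → ℂ) (β : ℝ), 0 ≤ β →
      (∀ p, ‖(C.codeChannel ρ H *ᵥ u) p‖ ≤ β) → ∃ y : Fin T × Fin nt → ℂ,
        (∀ l, u l = ∑ p : Fin T × Fin nt, (∑ i, G' l (p.1, i) * P i p.2) * y p) ∧
        ∀ p, v p.2 * ‖y p‖ ≤ c * (β / C.theta ρ) := by
    intro u β hβ hu
    have h1 : ∀ t : Fin T, ∃ y : Fin nt → ℂ,
        (∀ i, (C.generator *ᵥ u) (t, i) = ∑ k, P i k * y k) ∧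
        ∀ k, v k * ‖y k‖ ≤ c * (β / C.theta ρ) := by
      intro t
      refine hsolve (fun j => (C.generator *ᵥ u) (t, j)) _ (by positivity) fun i => ?_
      have := hu (t, i)
      rw [codeChannel_mulVec, norm_mul, Complex.norm_real, Real.norm_of_nonneg hθ.le] at this
      rw [le_div_iff₀ hθ, mul_comm]
      exact this
    choose y hy hyb using h1
    refine ⟨fun p => y p.1 p.2, fun l => ?_, fun p => hyb _ _⟩
    have h2 : u = G' *ᵥ (C.generator *ᵥ u) := by
      rw [Matrix.mulVec_mulVec, hG', Matrix.one_mulVec]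
    calc u l = ∑ t, ∑ i, G' l (t, i) * (C.generator *ᵥ u) (t, i) := by
          conv_lhs => rw [h2]
          exact Fintype.sum_prod_type fun p => G' l p * (C.generator *ᵥ u) p
      _ = _ := by
          rw [Fintype.sum_prod_type]
          refine Finset.sum_congr rfl fun t _ => ?_
          simp only [hy, Finset.mul_sum, Finset.sum_mul]
          rw [Finset.sum_comm]
          exact Finset.sum_congr rfl fun k _ => Finset.sum_congr rfl fun i _ => by ring
  have hinj : ∀ u : Fin (nt * T) → ℂ, C.codeChannel ρ H *ᵥ u = 0 → u = 0 := by
    intro u hu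
    obtain ⟨y, hy, hyb⟩ := hconf u 0 le_rfl fun p => by rw [hu]; simp
    have hy0 : ∀ p, y p = 0 := fun p => by
      have h1 := hyb p
      rw [zero_div, mul_zero] at h1
      have h2 := hv p.2
      have h3 := norm_nonneg (y p)
      exact norm_eq_zero.1 (le_antisymm (by nlinarith) h3)
    ext l
    rw [hy l]
    simp [hy0]
  have hdet : R.det ≠ 0 := by
    intro h0
    obtain ⟨u, hu0, hu⟩ := Matrix.exists_mulVec_eq_zero_iff.2 h0
    refine hu0 (hinj u ?_)
    rw [← hQR.2.2, ← Matrix.mulVec_mulVec, hu, Matrix.mulVec_zero]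
  set b : ℝ := ∏ i, (2 + C₀ * (2 * c + 4) * min (ξ / (C.theta ρ * v i)) L) ^ (2 * T) with hb
  have hlayer : ∀ k : Fin (nt * T), ((visitedNodes (C.eta ρ) ξ x R k).card : ℝ) ≤ b := by
    intro k
    rcases (visitedNodes (C.eta ρ) ξ x R k).eq_empty_or_nonempty with h0 | ⟨s₀, hs₀⟩
    · rw [h0, Finset.card_empty, Nat.cast_zero, hb]
      refine Finset.prod_nonneg fun i _ => ?_
      rw [pow_mul]
      exact pow_nonneg (sq_nonneg _) _
    have hmem : ∀ s ∈ visitedNodes (C.eta ρ) ξ x R k, (∀ i, s i ∈ constellation (C.eta ρ)) ∧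
        sqNorm (x ∘ lastIdx k - (R.submatrix (lastIdx k) (lastIdx k)) *ᵥ s) ≤ ξ ^ 2 := by
      intro s hs
      rw [visitedNodes, Finset.mem_filter, symbolVectors, Fintype.mem_piFinset] at hs
      exact hs
    set S := (visitedNodes (C.eta ρ) ξ x R k).image (· - s₀) with hS
    have hcard : S.card = (visitedNodes (C.eta ρ) ξ x R k).card :=
      Finset.card_image_of_injective _ (sub_left_injective)
    have hSmem : ∀ d ∈ S, ∃ s ∈ visitedNodes (C.eta ρ) ξ x R k, s - s₀ = d := fun d hd =>
      Finset.mem_image.1 hd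
    have hcount := card_le_prod_of_truncated_linear_image (ι := Fin T × Fin nt)
      (κ := Fin ((k : ℕ) + 1))
      (fun l p => ∑ i, G' (lastIdx k l) (p.1, i) * P i p.2) hK₀0 ?_
      (fun p => c * (2 * ξ / C.theta ρ) / v p.2) ?_ (L := 4 * L) (by positivity) S ?_ ?_ ?_
    · rw [← hcard]
      refine hcount.trans ?_
      rw [Fintype.prod_prod_type]
      dsimp only
      rw [Finset.prod_const, Finset.card_univ, Fintype.card_fin, ← Finset.prod_pow]
      simp only [Fintype.card_prod, Fintype.card_fin, ← pow_mul]
      rw [hb]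
      have hk : truncationConst (T * nt) (k + 1) K₀ ≤ C₀ := by
        have hk' : ((k : ℕ) + 1 : ℕ) ≤ (nt * T) := k.isLt
        rw [hC₀, truncationConst, truncationConst]
        gcongr
      refine Finset.prod_le_prod (fun i _ => ?_) fun i _ => ?_
      · rw [pow_mul]; exact pow_nonneg (sq_nonneg _) _
      · have hvi := hv i
        have h1 : 0 ≤ ξ / (C.theta ρ * v i) := by positivity
        have h2 : c * (2 * ξ / C.theta ρ) / v i = 2 * c * (ξ / (C.theta ρ * v i)) := by
          field_simp
        have h3 : min (c * (2 * ξ / C.theta ρ) / v i) (4 * L) ≤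
            (2 * c + 4) * min (ξ / (C.theta ρ * v i)) L := by
          rw [h2, mul_min_of_nonneg _ _ (by positivity)]
          refine min_le_min ?_ ?_
          · gcongr; linarith
          · gcongr; linarith
        have h4 : 0 ≤ min (c * (2 * ξ / C.theta ρ) / v i) (4 * L) := by
          rw [h2]; positivity
        have := hconst (k + 1)
        refine pow_le_pow_left₀ (by positivity) ?_ _
        rw [mul_assoc]
        gcongr
    · intro l
      calc _ ≤ ∑ p : Fin T × Fin nt, g * c := by
            refine Finset.sum_le_sum fun p _ => ?_
            calc _ ≤ ∑ i, ‖G' (lastIdx k l) (p.1, i)‖ * c := by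
                  refine norm_sum_le_of_le _ fun i _ => ?_
                  rw [norm_mul]
                  exact mul_le_mul_of_nonneg_left (hP _ _) (norm_nonneg _)
              _ ≤ g * c := by
                  rw [← Finset.sum_mul]
                  refine mul_le_mul_of_nonneg_right ?_ hc
                  calc _ ≤ ∑ t, ∑ i, ‖G' (lastIdx k l) (t, i)‖ :=
                        Finset.single_le_sum
                          (f := fun t => ∑ i, ‖G' (lastIdx k l) (t, i)‖)
                          (fun _ _ => Finset.sum_nonneg fun _ _ => norm_nonneg _)
                          (Finset.mem_univ p.1)
                    _ = ∑ q, ‖G' (lastIdx k l) q‖ :=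
                        (Fintype.sum_prod_type fun q => ‖G' (lastIdx k l) q‖).symm
                    _ ≤ g := Finset.single_le_sum (f := fun l => ∑ q, ‖G' l q‖)
                          (fun _ _ => Finset.sum_nonneg fun _ _ => norm_nonneg _)
                          (Finset.mem_univ _)
        _ = K₀ := by simp [hK₀]
    · intro p
      have := hv p.2
      positivity
    · intro d hd d' hd' hne
      obtain ⟨s, hs, rfl⟩ := hSmem d hd
      obtain ⟨s', hs', rfl⟩ := hSmem d' hd'
      obtain ⟨l, hl⟩ := Function.ne_iff.1 fun h : s = s' => hne (by rw [h])
      refine ⟨l, ?_⟩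
      rw [Pi.sub_apply, Pi.sub_apply, sub_sub_sub_cancel_right]
      exact one_le_norm_sub_of_mem_constellation ((hmem s hs).1 l) ((hmem s' hs').1 l) hl
    · intro d hd l
      obtain ⟨s, hs, rfl⟩ := hSmem d hd
      refine (norm_sub_le_of_mem_constellation ((hmem s hs).1 l) ((hmem s₀ hs₀).1 l)).trans ?_
      have := C.eta_le_alphabetSize ρ
      linarith
    · intro d hd
      obtain ⟨s, hs, rfl⟩ := hSmem d hd
      obtain ⟨u, hu, hun⟩ := exists_extend_lastIdx hQR.2.1 hdet k (s - s₀)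
      have hMu : sqNorm (C.codeChannel ρ H *ᵥ u) ≤ (2 * ξ) ^ 2 := by
        rw [hQR.sqNorm_mulVec, hun]
        have := sqNorm_sub_le (hmem s₀ hs₀).2 (hmem s hs).2
        rwa [sub_sub_sub_cancel_left, ← Matrix.mulVec_sub] at this
      obtain ⟨y, hy, hyb⟩ := hconf u (2 * ξ) (by positivity)
        (norm_le_of_sqNorm_le (by positivity) hMu)
      refine ⟨y, fun l => ?_, fun p => ?_⟩
      · rw [← hu, hy]
      · rw [le_div_iff₀ (hv _), mul_comm]
        exact hyb p
  rw [numVisitedNodes]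
  push_cast
  calc _ ≤ ∑ k : Fin (nt * T), b := Finset.sum_le_sum fun k _ => hlayer k
    _ = _ := by simp

end LDCode

/-! ### Asymptotics of the code parameters -/

theorem eventually_le_rpow_of_tendsto_log {f : ℝ → ℝ} {a b : ℝ}
    (hf : Tendsto (fun ρ => Real.log (f ρ) / Real.log ρ) atTop (𝓝 a))
    (hpos : ∀ᶠ ρ in atTop, 0 < f ρ) (hab : a < b) : ∀ᶠ ρ in atTop, f ρ ≤ ρ ^ b := by
  filter_upwards [hf.eventually (gt_mem_nhds hab), hpos, eventually_gt_atTop 1] with ρ h h0 h1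
  have hlog := Real.log_pos h1
  have hρ : 0 < ρ := zero_lt_one.trans h1
  rw [← Real.log_le_log_iff h0 (Real.rpow_pos_of_pos hρ _), Real.log_rpow hρ]
  exact ((div_lt_iff₀ hlog).1 h).le

theorem eventually_const_le_rpow (c : ℝ) {ε : ℝ} (hε : 0 < ε) :
    ∀ᶠ ρ : ℝ in atTop, c ≤ ρ ^ ε :=
  (tendsto_rpow_atTop hε).eventually_ge_atTop c

theorem card_constellation {η : ℝ} (hη : 0 < η) :
    ((constellation η).card : ℝ) = (2 * (⌊η⌋ : ℝ) + 1) ^ 2 := by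
  have hinj : Function.Injective fun p : ℤ × ℤ => (⟨(p.1 : ℝ), (p.2 : ℝ)⟩ : ℂ) := by
    intro p q h
    have h1 := congrArg Complex.re h
    have h2 := congrArg Complex.im h
    simp only [Int.cast_inj] at h1 h2
    exact Prod.ext h1 h2
  have h0 : 0 ≤ ⌊η⌋ := Int.floor_nonneg.2 hη.le
  have hI : ((Finset.Icc (-⌊η⌋) ⌊η⌋).card : ℤ) = 2 * ⌊η⌋ + 1 := by
    rw [Int.card_Icc, Int.toNat_of_nonneg (by omega)]
    ring
  have hI' : ((Finset.Icc (-⌊η⌋) ⌊η⌋).card : ℝ) = 2 * (⌊η⌋ : ℝ) + 1 := by exact_mod_cast hI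
  rw [constellation, Finset.card_image_of_injective _ hinj, Finset.card_product]
  push_cast
  rw [hI', sq]

theorem norm_le_of_mem_constellation {η : ℝ} {s : ℂ} (hs : s ∈ constellation η) :
    ‖s‖ ≤ 2 * η := by
  obtain ⟨a, b, ha, hb, h1, h2⟩ := mem_constellation.1 hs
  refine (Complex.norm_le_abs_re_add_abs_im _).trans ?_
  rw [h1, h2]
  linarith

namespace LDCode

variable {nt T : ℕ} (C : LDCode nt T)

theorem card_codebook (ρ : ℝ) :
    ((C.codebook ρ).card : ℝ) = C.alphabetSize ρ ^ (2 * (nt * T)) := by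
  have hinj : Function.Injective (C.encode ρ) := by
    intro s s' h
    have hθ : (C.theta ρ : ℂ) ≠ 0 := Complex.ofReal_ne_zero.2 (C.theta_pos ρ).ne'
    have h1 := smul_right_injective _ hθ h
    have h2 : ∑ i, (s i - s' i) • C.dispersion i = 0 := by
      simp only [sub_smul, Finset.sum_sub_distrib]
      exact sub_eq_zero.2 h1
    ext i
    exact sub_eq_zero.1 (Fintype.linearIndependent_iff.1 C.linearIndependent _ h2 i)
  rw [codebook, Finset.card_image_of_injective _ hinj, symbolVectors, Fintype.card_piFinset]
  push_cast
  rw [Finset.prod_const, card_constellation (C.eta_pos ρ), ← pow_mul, alphabetSize]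
  simp

theorem tendsto_log_alphabetSize {r : ℝ} (hnt : 0 < nt) (hT : 0 < T)
    (hr : C.HasMultiplexingGain r) :
    Tendsto (fun ρ => Real.log (C.alphabetSize ρ) / Real.log ρ) atTop (𝓝 (r / nt / 2)) := by
  have h := hr.mul_const (1 / (2 * nt : ℝ))
  have h1 : (nt : ℝ) ≠ 0 := by positivity
  have h2 : (T : ℝ) ≠ 0 := by positivity
  convert h using 1
  · ext ρ
    rw [card_codebook, Real.log_pow]
    push_cast
    field_simp
  · congr 1
    field_simp

/-- The power constraint bounds the scaling `θ` from below. -/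
theorem exists_inv_theta_le (hT : 0 < T) (hpower : C.PowerConstraint) :
    ∃ c : ℝ, ∀ᶠ ρ in atTop, 1 / C.theta ρ ≤ c * (C.alphabetSize ρ * ρ ^ (-(1 / 2) : ℝ)) := by
  set a : ℝ := ∑ x, ∑ y, (2 * ∑ i, ‖C.dispersion i x y‖) ^ 2 with ha
  have hcw : ∀ ρ, ∀ X ∈ C.codebook ρ, frobSq X ≤ a * (C.theta ρ * C.alphabetSize ρ) ^ 2 := by
    intro ρ X hX
    obtain ⟨s, hs, rfl⟩ := Finset.mem_image.1 hX
    rw [symbolVectors, Fintype.mem_piFinset] at hs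
    rw [frobSq, ha, Finset.sum_mul]
    refine Finset.sum_le_sum fun x _ => ?_
    rw [Finset.sum_mul]
    refine Finset.sum_le_sum fun y _ => ?_
    rw [← mul_pow]
    refine pow_le_pow_left₀ (norm_nonneg _) ?_ 2
    have hθ := C.theta_pos ρ
    rw [encode, Matrix.smul_apply, Matrix.sum_apply, norm_smul, Complex.norm_real,
      Real.norm_of_nonneg hθ.le]
    have h1 : ‖∑ i, (s i • C.dispersion i) x y‖ ≤
        ∑ i, 2 * C.alphabetSize ρ * ‖C.dispersion i x y‖ := by
      refine norm_sum_le_of_le _ fun i _ => ?_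
      rw [Matrix.smul_apply, norm_smul]
      refine mul_le_mul_of_nonneg_right ?_ (norm_nonneg _)
      linarith [norm_le_of_mem_constellation (hs i), C.eta_le_alphabetSize ρ]
    rw [← Finset.mul_sum] at h1
    calc _ ≤ C.theta ρ * (2 * C.alphabetSize ρ * ∑ i, ‖C.dispersion i x y‖) := by gcongr
      _ = _ := by ring
  refine ⟨√(a / T), ?_⟩
  filter_upwards [hpower, eventually_gt_atTop 0] with ρ hρ hρ0
  have hθ := C.theta_pos ρ
  have hL := C.one_le_alphabetSize ρ
  have hL0 : 0 < C.alphabetSize ρ := by linarith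
  have hcard : (0 : ℝ) < (C.codebook ρ).card := by
    rw [card_codebook]; positivity
  have hT' : (0 : ℝ) < T := by exact_mod_cast hT
  have h1 : ρ * T ≤ a * (C.theta ρ * C.alphabetSize ρ) ^ 2 := by
    rw [← hρ, one_div, inv_mul_le_iff₀ hcard, ← nsmul_eq_mul]
    exact Finset.sum_le_card_nsmul _ _ _ (hcw ρ)
  have ha0 : 0 ≤ a := by positivity
  rw [Real.rpow_neg hρ0.le, ← Real.sqrt_eq_rpow]
  have hs : 0 < √ρ := Real.sqrt_pos.2 hρ0
  rw [div_le_iff₀ hθ]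
  have h2 : √ρ ≤ √(a / T) * (C.alphabetSize ρ * C.theta ρ) := by
    rw [Real.sqrt_le_left (by positivity), mul_pow, Real.sq_sqrt (by positivity),
      div_mul_eq_mul_div, le_div_iff₀ hT', mul_comm (C.alphabetSize ρ)]
    exact h1
  calc (1 : ℝ) = √ρ * (√ρ)⁻¹ := (mul_inv_cancel₀ hs.ne').symm
    _ ≤ √(a / T) * (C.alphabetSize ρ * C.theta ρ) * (√ρ)⁻¹ := by gcongr
    _ = _ := by ring

theorem eventually_parameters_le {r : ℝ} (hnt : 0 < nt) (hT : 0 < T)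
    (hpower : C.PowerConstraint) (hr : C.HasMultiplexingGain r) {ξ : ℝ → ℝ}
    (hξ_pos : ∀ᶠ ρ in atTop, 0 < ξ ρ)
    (hξ : Tendsto (fun ρ : ℝ => Real.log (ξ ρ) / Real.log ρ) atTop (𝓝 0)) {ε : ℝ} (hε : 0 < ε) :
    ∀ᶠ ρ in atTop, C.alphabetSize ρ ≤ ρ ^ (r / nt / 2 + ε) ∧
      ξ ρ / C.theta ρ ≤ ρ ^ ((r / nt - 1) / 2 + ε) := by
  obtain ⟨c, hc⟩ := C.exists_inv_theta_le hT hpower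
  have hLpos : ∀ ρ, 0 < C.alphabetSize ρ := fun ρ => by linarith [C.one_le_alphabetSize ρ]
  have hL := eventually_le_rpow_of_tendsto_log (C.tendsto_log_alphabetSize hnt hT hr)
    (Eventually.of_forall hLpos) (show r / nt / 2 < r / nt / 2 + ε / 3 by linarith)
  have hX := eventually_le_rpow_of_tendsto_log hξ hξ_pos (show (0 : ℝ) < ε / 3 by linarith)
  filter_upwards [hc, hL, hX, hξ_pos, eventually_const_le_rpow c (show 0 < ε / 3 by linarith),
    eventually_gt_atTop 1] with ρ h1 h2 h3 h4 h5 h6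
  have hρ : 0 < ρ := by linarith
  refine ⟨h2.trans (Real.rpow_le_rpow_of_exponent_le h6.le (by linarith)), ?_⟩
  have hp := Real.rpow_pos_of_pos hρ
  have hLp := hLpos ρ
  calc ξ ρ / C.theta ρ = ξ ρ * (1 / C.theta ρ) := by ring
    _ ≤ ρ ^ (ε / 3) * (ρ ^ (ε / 3) * (ρ ^ (r / nt / 2 + ε / 3) * ρ ^ (-(1 / 2) : ℝ))) := by
        refine mul_le_mul h3 (h1.trans ?_) (one_div_pos.2 (C.theta_pos ρ)).le (hp _).le
        have := hp (-(1 / 2))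
        exact mul_le_mul h5 (mul_le_mul_of_nonneg_right h2 this.le) (by positivity) (hp _).le
    _ = _ := by
        rw [← Real.rpow_add hρ, ← Real.rpow_add hρ, ← Real.rpow_add hρ]
        congr 1
        ring

end LDCode

/-- The singularity level of a pivot `v`: the exponent `a` of `v ^ 2 = ρ ^ (-a)`, truncated to
`[0, 1]`. -/
noncomputable def singularityLevel (ρ v : ℝ) : ℝ := max 0 (min 1 (-2 * Real.log v / Real.log ρ))

/-- One factor of the bound for the number of nodes, in terms of the singularity level of its
pivot; here `q` is `r / nt`. The alphabet bound `L` takes over at level `1`, so truncating the level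
there loses nothing. -/
theorem two_add_mul_min_le {ρ ε q K B L v : ℝ} (hρ : 1 < ρ) (hε : 0 < ε)
    (hK : 0 ≤ K) (hKρ : 2 + K ≤ ρ ^ ε) (hL : L ≤ ρ ^ (q / 2 + ε))
    (hB : B ≤ ρ ^ ((q - 1) / 2 + ε)) (hv : 0 < v) :
    2 + K * min (B / v) L ≤
      ρ ^ (2 * ε + max (min (q - 1 + singularityLevel ρ v) q) 0 / 2) := by
  have hρ0 : 0 < ρ := by linarith
  have hlog := Real.log_pos hρ
  set a := -2 * Real.log v / Real.log ρ with ha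
  have hva : ρ ^ (-a / 2) = v := by
    rw [Real.rpow_def_of_pos hρ0, ha]
    rw [show Real.log ρ * (-(-2 * Real.log v / Real.log ρ) / 2) = Real.log v by field_simp]
    exact Real.exp_log hv
  set t := max (min (q - 1 + singularityLevel ρ v) q) 0 with ht
  have ht0 : 0 ≤ t := le_max_right _ _
  have hmin : min (B / v) L ≤ ρ ^ (ε + t / 2) := by
    have hlev : singularityLevel ρ v = max 0 (min 1 a) := rfl
    rcases le_total 1 a with h1 | h1
    · refine (min_le_right _ _).trans (hL.trans (Real.rpow_le_rpow_of_exponent_le hρ.le ?_))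
      have : q ≤ t := by
        rw [ht, hlev, min_eq_left h1, max_eq_right zero_le_one]
        simp
      linarith
    · refine (min_le_left _ _).trans ?_
      have hBv : B / v ≤ ρ ^ ((q - 1) / 2 + ε + a / 2) := by
        rw [div_le_iff₀ hv]
        refine le_trans ?_ (mul_le_mul_of_nonneg_left hva.le (Real.rpow_nonneg hρ0.le _))
        rw [← Real.rpow_add hρ0]
        refine hB.trans (le_of_eq ?_)
        congr 1
        ring
      refine hBv.trans (Real.rpow_le_rpow_of_exponent_le hρ.le ?_)
      have : q - 1 + a ≤ t := by
        have h2 : a ≤ singularityLevel ρ v := by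
          rw [hlev, min_eq_right h1]; exact le_max_right _ _
        refine le_trans (le_min ?_ ?_) (le_max_left _ _) <;> linarith
      linarith
  have hone : 1 ≤ ρ ^ (ε + t / 2) := Real.one_le_rpow hρ.le (by positivity)
  calc 2 + K * min (B / v) L ≤ 2 + K * ρ ^ (ε + t / 2) := by gcongr
    _ ≤ (2 + K) * ρ ^ (ε + t / 2) := by linarith
    _ ≤ ρ ^ ε * ρ ^ (ε + t / 2) := by gcongr
    _ = _ := by
        rw [← Real.rpow_add hρ0]
        congr 1
        ring

/-! ### The optimization problem -/

theorem isCompact_feasibleLevels {nt nr : ℕ} (h : nt ≤ nr) (d : ℝ) :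
    IsCompact (feasibleLevels nt nr d) := by
  have hcoef : ∀ i : Fin nt, (1 : ℝ) ≤ (nr : ℝ) - nt + 2 * ((i : ℝ) + 1) - 1 := fun i => by
    have h1 : (nt : ℝ) ≤ nr := by exact_mod_cast h
    have h2 : (0 : ℝ) ≤ i := Nat.cast_nonneg _
    linarith
  refine (isCompact_univ_pi fun _ : Fin nt => isCompact_Icc (a := (0 : ℝ)) (b := d)).of_isClosed_subset
    ?_ fun α hα i _ => ⟨hα.2.1 i, ?_⟩
  · refine IsClosed.inter ?_ (IsClosed.inter ?_ ?_)
    · exact isClosed_antitone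
    · exact isClosed_le (f := fun _ : Fin nt → ℝ => (0 : Fin nt → ℝ)) continuous_const continuous_id
    · exact isClosed_le (f := fun α : Fin nt → ℝ =>
        ∑ i : Fin nt, ((nr : ℝ) - nt + 2 * ((i : ℝ) + 1) - 1) * α i) (by fun_prop) continuous_const
  · refine le_trans ?_ hα.2.2
    refine le_trans ?_ (Finset.single_le_sum (f := fun i : Fin nt =>
      ((nr : ℝ) - nt + 2 * ((i : ℝ) + 1) - 1) * α i)
      (fun j _ => mul_nonneg (by linarith [hcoef j]) (hα.2.1 j)) (Finset.mem_univ i))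
    exact le_mul_of_one_le_left (hα.2.1 i) (hcoef i)

theorem continuous_objective (nt T : ℕ) (r : ℝ) : Continuous (objective nt T r) := by
  unfold objective
  fun_prop

theorem exists_isGreatest_objective {nt nr : ℕ} (T : ℕ) (h : nt ≤ nr) (r : ℝ) {d : ℝ}
    (hd : 0 ≤ d) : ∃ c, IsGreatest (objective nt T r '' feasibleLevels nt nr d) c := by
  have hne : (feasibleLevels nt nr d).Nonempty :=
    ⟨0, antitone_const, fun _ => le_rfl, by simpa using hd⟩
  exact ((isCompact_feasibleLevels h d).image (continuous_objective nt T r)).exists_isGreatest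
    (hne.image _)

/-- In terms of the pivots, which are indexed from the largest to the smallest, a monotone
vector of levels with a large objective has a large exponent of probability. -/
theorem lt_sum_of_lt_objective {nt nr T : ℕ} (h : nt ≤ nr) {r d c : ℝ}
    (hc : c ∈ upperBounds (objective nt T r '' feasibleLevels nt nr d)) {a : Fin nt → ℝ}
    (hmono : Monotone a) (ha : ∀ k, 0 ≤ a k)
    (hobj : c < ∑ k, (T : ℝ) * max (min (r / nt - 1 + a k) (r / nt)) 0) :
    d < ∑ k : Fin nt, ((nr + nt - 2 * (k : ℕ) - 1 : ℕ) : ℝ) * a k := by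
  by_contra! hle
  refine hobj.not_ge (hc ⟨fun i => a i.rev, ⟨?_, fun i => ha _, ?_⟩, ?_⟩)
  · exact fun i j hij => hmono (Fin.rev_le_rev.2 hij)
  · refine le_trans (le_of_eq ?_) hle
    rw [← Equiv.sum_comp Fin.revPerm]
    refine Finset.sum_congr rfl fun k _ => ?_
    beta_reduce
    rw [Fin.revPerm_apply, Fin.rev_rev]
    congr 1
    have := k.isLt
    have h1 : nr + nt - 2 * (k : ℕ) - 1 + 2 * k + 1 = nr + nt := by omega
    have h2 : ((Fin.rev k : ℕ) : ℝ) + k + 1 = nt := by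
      have : (Fin.rev k : ℕ) + k + 1 = nt := by rw [Fin.val_rev]; omega
      exact_mod_cast this
    have h3 : ((nr + nt - 2 * (k : ℕ) - 1 : ℕ) : ℝ) + 2 * k + 1 = nr + nt := by
      exact_mod_cast h1
    linarith
  · exact Equiv.sum_comp Fin.revPerm fun k => (T : ℝ) * max (min (r / nt - 1 + a k) (r / nt)) 0

/-! ### The probability of an atypical channel -/

/-- Events that concern the channel matrix only; no measurability is required. -/
theorem channelLaw_le {nt T nr : ℕ} (C : LDCode nt T) (ρ : ℝ)
    (S : Set (Fin nr → Fin nt → ℂ)) :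
    channelLaw nr C ρ {ω | ω.2.1 ∈ S} ≤ gaussianArray nr nt S := by
  have : {ω : Outcome nt nr T | ω.2.1 ∈ S} = Set.univ ×ˢ (S ×ˢ Set.univ) := by
    ext; simp
  rw [this, channelLaw, Measure.prod_prod, Measure.prod_prod,
    measure_univ (μ := gaussianArray nr T), mul_one]
  exact mul_le_of_le_one_left' prob_le_one

/-- Almost surely no pivot vanishes: the arrays with entries at most `K` and a zero pivot lie in a
pivot set of volume zero. -/
theorem gaussianArray_zero_pivot {m n : ℕ} (h : n ≤ m) :
    gaussianArray m n {H | ∃ K : ℕ, ∃ k, H ∈ pivotSet m n fun j => if j = k then 0 else K} = 0 := by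
  have : {H | ∃ K : ℕ, ∃ k, H ∈ pivotSet m n fun j => if j = k then (0 : ℝ) else K} =
      ⋃ K : ℕ, ⋃ k, pivotSet m n fun j => if j = k then (0 : ℝ) else K := by
    ext; simp
  rw [this, measure_iUnion_null_iff]
  intro K
  rw [measure_iUnion_null_iff]
  intro k
  refine le_antisymm ((gaussianArray_le_volume m n _).trans ?_) zero_le
  obtain ⟨c, -, hle⟩ := volume_pivotSet_le m n h
  refine (hle _).trans (le_of_eq ?_)
  have hk := k.isLt
  rw [Finset.prod_eq_zero (Finset.mem_univ k), mul_zero]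
  rw [if_pos rfl, ENNReal.ofReal_zero]
  exact zero_pow (by omega)

theorem volume_pivotSet_rpow_le {m n : ℕ} (h : n ≤ m) : ∃ c : ℝ, 0 ≤ c ∧
    ∀ (ρ : ℝ), 0 < ρ → ∀ (ε : ℝ) (a : Fin n → ℝ),
      volume (pivotSet m n fun k => 2 ^ n * ρ ^ (ε - a k / 2)) ≤ ENNReal.ofReal
        (c * ρ ^ (2 * ε * (∑ k : Fin n, ((m + n - 2 * (k : ℕ) - 1 : ℕ) : ℝ)) -
          ∑ k : Fin n, ((m + n - 2 * (k : ℕ) - 1 : ℕ) : ℝ) * a k)) := by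
  obtain ⟨c, hc, hle⟩ := volume_pivotSet_le m n h
  refine ⟨c.toReal * ∏ k : Fin n, ((2 : ℝ) ^ n) ^ (2 * (m + n - 2 * (k : ℕ) - 1)), by positivity,
    fun ρ hρ ε a => (hle _).trans (le_of_eq ?_)⟩
  have hp := Real.rpow_pos_of_pos hρ
  rw [mul_assoc, ENNReal.ofReal_mul ENNReal.toReal_nonneg, ENNReal.ofReal_toReal hc]
  congr 1
  have h1 : ∀ k : Fin n, ENNReal.ofReal (2 ^ n * ρ ^ (ε - a k / 2)) ^
      (2 * (m + n - 2 * (k : ℕ) - 1)) = ENNReal.ofReal (((2 : ℝ) ^ n) ^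
        (2 * (m + n - 2 * (k : ℕ) - 1)) *
        ρ ^ (2 * ε * ((m + n - 2 * (k : ℕ) - 1 : ℕ) : ℝ) -
          ((m + n - 2 * (k : ℕ) - 1 : ℕ) : ℝ) * a k)) := by
    intro k
    have := hp (ε - a k / 2)
    rw [← ENNReal.ofReal_pow (by positivity), mul_pow, ← Real.rpow_natCast (ρ ^ (ε - a k / 2)),
      ← Real.rpow_mul hρ.le]
    congr 3
    push_cast
    ring
  rw [Finset.prod_congr rfl fun k _ => h1 k, ← ENNReal.ofReal_prod_of_nonneg, Finset.prod_mul_distrib,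
    ← Real.rpow_sum_of_pos hρ, Finset.sum_sub_distrib, Finset.mul_sum]
  intro k _
  exact mul_nonneg (by positivity) (hp _).le

theorem le_snrExponent {p : ℝ≥0∞} {ρ s : ℝ} (hρ : 1 < ρ) (hp : p ≤ ENNReal.ofReal (ρ ^ (-s))) :
    (s : EReal) ≤ snrExponent p ρ := by
  have hρ0 : 0 < ρ := by linarith
  have hlog := Real.log_pos hρ
  have h1 : ENNReal.log p ≤ ((-s * Real.log ρ : ℝ) : EReal) := by
    refine (ENNReal.log_le_log hp).trans ?_
    rw [ENNReal.log_ofReal_of_pos (Real.rpow_pos_of_pos hρ0 _), Real.log_rpow hρ0]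
  rw [snrExponent, EReal.le_neg]
  refine (EReal.div_le_div_right_of_nonneg (by exact_mod_cast hlog.le) h1).trans (le_of_eq ?_)
  rw [← EReal.coe_div, mul_div_cancel_right₀ _ hlog.ne', EReal.coe_neg]

/-! ### Typical channels visit few nodes -/

theorem singularityLevel_nonneg (ρ v : ℝ) : 0 ≤ singularityLevel ρ v := le_max_left _ _

theorem singularityLevel_le_one (ρ v : ℝ) : singularityLevel ρ v ≤ 1 :=
  max_le zero_le_one (min_le_left _ _)

theorem singularityLevel_anti {ρ v w : ℝ} (hρ : 1 < ρ) (hv : 0 < v) (hvw : v ≤ w) :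
    singularityLevel ρ w ≤ singularityLevel ρ v := by
  have hlog := Real.log_pos hρ
  have := Real.log_le_log hv hvw
  unfold singularityLevel
  gcongr max 0 (min 1 (?_ / _))
  linarith

/-- A pivot `v ≤ ρ ^ ε` is small if its singularity level is large. The factor `ρ ^ ε` is needed
for level `0` only. -/
theorem le_rpow_of_le_singularityLevel {ρ v ε a : ℝ} (hρ : 1 < ρ) (hv : 0 < v) (hε : 0 ≤ ε)
    (hvε : v ≤ ρ ^ ε) (ha0 : 0 ≤ a) (ha : a ≤ singularityLevel ρ v) : v ≤ ρ ^ (ε - a / 2) := by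
  have hρ0 : 0 < ρ := by linarith
  have hlog := Real.log_pos hρ
  rcases ha0.eq_or_lt with rfl | hpos
  · simpa using hvε
  have h1 : a ≤ -2 * Real.log v / Real.log ρ := by
    rcases le_max_iff.1 ha with h | h
    · linarith
    · exact h.trans (min_le_right _ _)
  rw [le_div_iff₀ hlog] at h1
  rw [← Real.log_le_log_iff hv (Real.rpow_pos_of_pos hρ0 _), Real.log_rpow hρ0]
  nlinarith

theorem prod_pow_le_rpow {n T : ℕ} {ρ ε : ℝ} (hρ : 0 < ρ) {b t : Fin n → ℝ}
    (hb0 : ∀ i, 0 ≤ b i) (hb : ∀ i, b i ≤ ρ ^ (2 * ε + t i / 2)) :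
    ∏ i, b i ^ (2 * T) ≤ ρ ^ (4 * T * n * ε + ∑ i, T * t i) := by
  calc ∏ i, b i ^ (2 * T) ≤ ∏ i : Fin n, ρ ^ (4 * T * ε + T * t i) := by
        refine Finset.prod_le_prod (fun i _ => pow_nonneg (hb0 i) _) fun i _ => ?_
        refine (pow_le_pow_left₀ (hb0 i) (hb i) _).trans (le_of_eq ?_)
        rw [← Real.rpow_natCast, ← Real.rpow_mul hρ.le]
        congr 1
        push_cast
        ring
    _ = _ := by
        rw [← Real.rpow_sum_of_pos hρ, Finset.sum_add_distrib]
        congr 2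
        simp
        ring

/-- If at least `ρ ^ x` nodes are visited, then the channel has an exceptionally large entry, or
a zero pivot, or its singularity levels, rounded down to multiples of `1 / M`, have an objective
close to `x`. -/
theorem eventually_subset_pivotSet {nt nr T : ℕ} (hnt : 0 < nt) (hT : 0 < T) (hnr : nt ≤ nr)
    (C : LDCode nt T) (hpower : C.PowerConstraint) {r : ℝ} (hr : C.HasMultiplexingGain r)
    (Q : ℝ → Matrix (Fin nr) (Fin nt) ℂ → Matrix (Fin T × Fin nr) (Fin (nt * T)) ℂ)
    (R : ℝ → Matrix (Fin nr) (Fin nt) ℂ → Matrix (Fin (nt * T)) (Fin (nt * T)) ℂ)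
    (hQR : ∀ ρ H, IsThinQR (C.codeChannel ρ H) (Q ρ H) (R ρ H))
    {ξ : ℝ → ℝ} (hξ_pos : ∀ᶠ ρ in atTop, 0 < ξ ρ)
    (hξ : Tendsto (fun ρ : ℝ => Real.log (ξ ρ) / Real.log ρ) atTop (𝓝 0))
    {M : ℕ} (hM : 0 < M) {x ε : ℝ} (hε : 0 < ε) :
    ∀ᶠ ρ in atTop, ∀ ω : Outcome nt nr T, ρ ^ x ≤ (sdNodes C ξ Q R ρ ω : ℝ) →
      ω.2.1 ∈ {H | ∃ i j, ρ ^ ε < ‖H i j‖} ∪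
        {H | ∃ K : ℕ, ∃ k, H ∈ pivotSet nr nt fun j => if j = k then 0 else K} ∪
        ⋃ g ∈ {g : Fin nt → Fin (M + 1) | Monotone g ∧
          x - (ε + 4 * T * nt * ε + T * nt / M) ≤
            ∑ k, (T : ℝ) * max (min (r / nt - 1 + (g k : ℕ) / M) (r / nt)) 0},
          pivotSet nr nt fun k => 2 ^ nt * ρ ^ (ε - ((g k : ℕ) / M : ℝ) / 2) := by
  obtain ⟨c, hc, hpiv⟩ := exists_pivots nt
  obtain ⟨K, hK, hbound⟩ := C.exists_numVisitedNodes_le hc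
  have hM' : (0 : ℝ) < M := by exact_mod_cast hM
  filter_upwards [C.eventually_parameters_le hnt hT hpower hr hξ_pos hξ hε, hξ_pos,
    eventually_const_le_rpow (2 + K) hε, eventually_const_le_rpow (nt * T : ℕ) hε,
    eventually_gt_atTop 1] with ρ ⟨hL, hB⟩ hξρ hKρ hκρ hρ ω hω
  have hρ0 : 0 < ρ := by linarith
  obtain ⟨v, hanti, hnn, hmax, hmem, P, hP, hsolve⟩ := hpiv nr hnr ω.2.1
  by_cases htail : ∃ i j, ρ ^ ε < ‖ω.2.1 i j‖
  · exact Or.inl (Or.inl htail)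
  push Not at htail
  by_cases hzero : ∃ k, v k = 0
  · obtain ⟨k, hk⟩ := hzero
    obtain ⟨N, hN⟩ := exists_nat_ge (2 ^ nt * ρ ^ ε)
    refine Or.inl (Or.inr ⟨N, k, hmem _ fun j => ?_⟩)
    split_ifs with hj
    · rw [hj, hk, mul_zero]
    · refine le_trans ?_ hN
      have := hmax _ htail j
      gcongr
  push Not at hzero
  have hv : ∀ k, 0 < v k := fun k => (hnn k).lt_of_ne (hzero k).symm
  right
  set a : Fin nt → ℝ := fun k => singularityLevel ρ (v k) with ha
  have ha0 : ∀ k, 0 ≤ M * a k := fun k => mul_nonneg hM'.le (singularityLevel_nonneg _ _)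
  have hg : ∀ k, ⌊M * a k⌋₊ < M + 1 := fun k => by
    rw [Nat.lt_succ_iff]
    refine Nat.floor_le_of_le ?_
    have := singularityLevel_le_one ρ (v k)
    exact mul_le_of_le_one_right hM'.le this
  have hup : ∀ k, a k ≤ ⌊M * a k⌋₊ / M + 1 / M := fun k => by
    rw [← add_div, le_div_iff₀ hM', mul_comm]
    exact (Nat.lt_floor_add_one _).le
  refine Set.mem_iUnion₂.2 ⟨fun k => ⟨⌊M * a k⌋₊, hg k⟩, ⟨?_, ?_⟩, ?_⟩
  · intro k l hkl
    refine Fin.mk_le_mk.2 (Nat.floor_le_floor ?_)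
    exact mul_le_mul_of_nonneg_left (singularityLevel_anti hρ (hv l) (hanti hkl)) hM'.le
  · have hN := hbound ρ ω.H (Q ρ ω.H) (R ρ ω.H) (hQR ρ ω.H) v hv P hP hsolve (ξ ρ)
      ((Q ρ ω.H)ᴴ *ᵥ Matrix.vec ω.Y) hξρ
    have hL0 := C.one_le_alphabetSize ρ
    have hθ := C.theta_pos ρ
    have hprod := prod_pow_le_rpow (T := T) (ε := ε) hρ0
      (b := fun i => 2 + K * min (ξ ρ / (C.theta ρ * v i)) (C.alphabetSize ρ))
      (t := fun i => max (min (r / nt - 1 + a i) (r / nt)) 0) (fun i => by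
        have := hv i
        positivity) (fun i => by
        rw [← div_div]
        exact two_add_mul_min_le hρ hε hK hKρ hL hB (hv i))
    have hx : ρ ^ x ≤ ρ ^ (ε + (4 * T * nt * ε +
        ∑ i, (T : ℝ) * max (min (r / nt - 1 + a i) (r / nt)) 0)) := by
      rw [Real.rpow_add hρ0]
      refine (hω.trans hN).trans (mul_le_mul hκρ hprod ?_ (Real.rpow_nonneg hρ0.le _))
      refine Finset.prod_nonneg fun i _ => pow_nonneg ?_ _
      have := hv i
      positivity
    have hx' := (Real.rpow_le_rpow_left_iff hρ).1 hx
    have hsum : ∑ i, (T : ℝ) * max (min (r / nt - 1 + a i) (r / nt)) 0 ≤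
        ∑ k, (T : ℝ) * max (min (r / nt - 1 + ⌊M * a k⌋₊ / M) (r / nt)) 0 + T * nt / M := by
      have : (T : ℝ) * nt / M = ∑ k : Fin nt, (T : ℝ) * (1 / M) := by simp; ring
      rw [this, ← Finset.sum_add_distrib]
      refine Finset.sum_le_sum fun k _ => ?_
      rw [← mul_add]
      refine mul_le_mul_of_nonneg_left ?_ (Nat.cast_nonneg _)
      have h1 : (0 : ℝ) ≤ 1 / M := by positivity
      have h2 := hup k
      refine max_le ?_ (add_nonneg (le_max_right _ _) h1)
      refine le_trans ?_ (add_le_add_left (le_max_left _ _) _)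
      rw [← min_add_add_right]
      refine min_le_min ?_ ?_ <;> linarith
    simp only
    linarith
  · refine hmem _ fun k => ?_
    refine mul_le_mul_of_nonneg_left ?_ (by positivity)
    refine le_rpow_of_le_singularityLevel hρ (hv k) hε.le (hmax _ htail k) (by positivity) ?_
    rw [div_le_iff₀ hM', mul_comm]
    exact Nat.floor_le (ha0 k)

/-- Beyond the maximum of the optimization problem, the probability of visiting `ρ ^ x` nodes
decays faster than `ρ ^ (-d)`. -/
theorem lt_Psi {nt nr T : ℕ} (hnt : 0 < nt) (hT : 0 < T) (hnr : nt ≤ nr)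
    (C : LDCode nt T) (hpower : C.PowerConstraint) {r : ℝ} (hr : C.HasMultiplexingGain r)
    (Q : ℝ → Matrix (Fin nr) (Fin nt) ℂ → Matrix (Fin T × Fin nr) (Fin (nt * T)) ℂ)
    (R : ℝ → Matrix (Fin nr) (Fin nt) ℂ → Matrix (Fin (nt * T)) (Fin (nt * T)) ℂ)
    (hQR : ∀ ρ H, IsThinQR (C.codeChannel ρ H) (Q ρ H) (R ρ H))
    {ξ : ℝ → ℝ} (hξ_pos : ∀ᶠ ρ in atTop, 0 < ξ ρ)
    (hξ : Tendsto (fun ρ : ℝ => Real.log (ξ ρ) / Real.log ρ) atTop (𝓝 0)) {d c x : ℝ}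
    (hc : c ∈ upperBounds (objective nt T r '' feasibleLevels nt nr d)) (hx : c < x) :
    (d : EReal) < Psi C ξ Q R x := by
  classical
  set e : Fin nt → ℝ := fun k => ((nr + nt - 2 * (k : ℕ) - 1 : ℕ) : ℝ) with he
  obtain ⟨M, hMx⟩ := exists_nat_gt (2 * (T * nt) / (x - c))
  have hxc : 0 < x - c := by linarith
  have hM' : (0 : ℝ) < M := lt_of_le_of_lt (by positivity) hMx
  have hM : 0 < M := by exact_mod_cast hM'
  have hMx' : (T * nt : ℝ) / M < (x - c) / 2 := by
    rw [div_lt_iff₀ hxc] at hMx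
    rw [div_lt_iff₀ hM']
    linarith
  -- The finitely many grid points with an objective above `c` have exponents bounded away
  -- from `d`.
  obtain ⟨γ, hγ, hgap⟩ : ∃ γ : ℝ, 0 < γ ∧ ∀ g : Fin nt → Fin (M + 1), Monotone g →
      c < ∑ k, (T : ℝ) * max (min (r / nt - 1 + (g k : ℕ) / M) (r / nt)) 0 →
      d + γ ≤ ∑ k, e k * ((g k : ℕ) / M : ℝ) := by
    have hfin : ∀ g : Fin nt → Fin (M + 1), ∃ γ : ℝ, 0 < γ ∧ (Monotone g →
        c < ∑ k, (T : ℝ) * max (min (r / nt - 1 + (g k : ℕ) / M) (r / nt)) 0 →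
        d + γ ≤ ∑ k, e k * ((g k : ℕ) / M : ℝ)) := by
      intro g
      by_cases h : Monotone g ∧
        c < ∑ k, (T : ℝ) * max (min (r / nt - 1 + (g k : ℕ) / M) (r / nt)) 0
      · have := lt_sum_of_lt_objective (a := fun k => ((g k : ℕ) / M : ℝ)) hnr hc (fun k l hkl => by
          have : (g k : ℕ) ≤ g l := h.1 hkl
          beta_reduce
          gcongr) (fun k => by positivity) h.2
        exact ⟨_, sub_pos.2 this, fun _ _ => by rw [add_sub_cancel]⟩
      · exact ⟨1, one_pos, fun h1 h2 => absurd ⟨h1, h2⟩ h⟩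
    choose γ hγ hgap using hfin
    obtain ⟨g₀, hg₀⟩ := Finite.exists_min γ
    exact ⟨γ g₀, hγ g₀, fun g h1 h2 => by linarith [hgap g h1 h2, hg₀ g]⟩
  set E := ∑ k, e k with hE
  have hE0 : 0 ≤ E := Finset.sum_nonneg fun k _ => Nat.cast_nonneg _
  set D : ℝ := 1 + 4 * T * nt with hD
  have hD0 : 0 < D := by positivity
  obtain ⟨ε, hε, hε1, hε2⟩ : ∃ ε : ℝ, 0 < ε ∧ D * ε < (x - c) / 2 ∧ 2 * ε * E ≤ γ / 2 := by
    refine ⟨min ((x - c) / (4 * D)) (γ / (4 * (E + 1))), by positivity, ?_, ?_⟩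
    · calc _ ≤ D * ((x - c) / (4 * D)) := by gcongr; exact min_le_left _ _
        _ = (x - c) / 4 := by field_simp
        _ < _ := by linarith
    · calc _ ≤ 2 * (γ / (4 * (E + 1))) * E := by gcongr; exact min_le_right _ _
        _ = γ / 2 * (E / (E + 1)) := by field_simp; ring
        _ ≤ γ / 2 * 1 := by
            gcongr
            rw [div_le_one (by positivity)]; linarith
        _ = _ := mul_one _
  obtain ⟨p, hp⟩ := exists_nat_ge ((d + γ / 2) / ε)
  rw [div_le_iff₀ hε] at hp
  obtain ⟨c₁, hc₁⟩ := gaussianArray_tail nr nt p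
  obtain ⟨c₂, hc₂0, hc₂⟩ := volume_pivotSet_rpow_le hnr
  set s := d + γ / 2 with hs
  set c₃ : ℝ := |c₁| + (Fintype.card (Fin nt → Fin (M + 1)) : ℝ) * c₂ with hc₃
  have hmain : ∀ᶠ ρ in atTop, ((d + γ / 4 : ℝ) : EReal) ≤ snrExponent
      (channelLaw nr C ρ {ω | ρ ^ x ≤ (sdNodes C ξ Q R ρ ω : ℝ)}) ρ := by
    filter_upwards [eventually_subset_pivotSet hnt hT hnr C hpower hr Q R hQR hξ_pos hξ hM
      (x := x) hε, eventually_const_le_rpow c₃ (show 0 < γ / 4 by linarith),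
      eventually_gt_atTop 1] with ρ hsub hρc hρ
    have hρ0 : 0 < ρ := by linarith
    refine le_snrExponent hρ ?_
    refine ((measure_mono hsub).trans (channelLaw_le C ρ _)).trans ?_
    have htail : gaussianArray nr nt {H | ∃ i j, ρ ^ ε < ‖H i j‖} ≤
        ENNReal.ofReal (|c₁| * ρ ^ (-s)) := by
      refine (hc₁ _ (Real.rpow_pos_of_pos hρ0 ε)).trans (ENNReal.ofReal_le_ofReal ?_)
      rw [div_eq_mul_inv, ← Real.rpow_natCast, ← Real.rpow_mul hρ0.le, ← Real.rpow_neg hρ0.le]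
      refine mul_le_mul (le_abs_self _) (Real.rpow_le_rpow_of_exponent_le hρ.le (by linarith))
        (Real.rpow_nonneg hρ0.le _) (abs_nonneg _)
    have hgrid : ∀ g : Fin nt → Fin (M + 1), (Monotone g ∧
          x - (ε + 4 * T * nt * ε + T * nt / M) ≤
            ∑ k, (T : ℝ) * max (min (r / nt - 1 + (g k : ℕ) / M) (r / nt)) 0) →
        gaussianArray nr nt (pivotSet nr nt fun k => 2 ^ nt * ρ ^ (ε - ((g k : ℕ) / M : ℝ) / 2))
          ≤ ENNReal.ofReal (c₂ * ρ ^ (-s)) := by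
      rintro g ⟨hg1, hg2⟩
      refine (gaussianArray_le_volume _ _ _).trans ((hc₂ ρ hρ0 ε _).trans
        (ENNReal.ofReal_le_ofReal ?_))
      have hD' : D * ε = ε + 4 * T * nt * ε := by rw [hD]; ring
      have := hgap g hg1 (by linarith)
      refine mul_le_mul_of_nonneg_left (Real.rpow_le_rpow_of_exponent_le hρ.le ?_) hc₂0
      linarith
    have hr0 : 0 ≤ ρ ^ (-s) := Real.rpow_nonneg hρ0.le _
    calc _ ≤ ENNReal.ofReal (|c₁| * ρ ^ (-s)) + 0 +
          ∑ g : Fin nt → Fin (M + 1), ENNReal.ofReal (c₂ * ρ ^ (-s)) := by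
          refine (measure_union_le _ _).trans (add_le_add ((measure_union_le _ _).trans
            (add_le_add htail (gaussianArray_zero_pivot hnr).le)) ?_)
          refine (measure_iUnion_fintype_le _ _).trans (Finset.sum_le_sum fun g _ => ?_)
          by_cases hg : Monotone g ∧
            x - (ε + 4 * T * nt * ε + T * nt / M) ≤
              ∑ k, (T : ℝ) * max (min (r / nt - 1 + (g k : ℕ) / M) (r / nt)) 0
          · refine (measure_mono (Set.iUnion_subset fun _ => subset_rfl)).trans (hgrid g hg)
          · refine (measure_mono (t := ∅) (Set.iUnion_subset fun h => absurd h hg)).trans ?_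
            simp
      _ = ENNReal.ofReal (c₃ * ρ ^ (-s)) := by
          rw [Finset.sum_const, Finset.card_univ, nsmul_eq_mul, add_zero,
            ← ENNReal.ofReal_natCast, ← ENNReal.ofReal_mul (Nat.cast_nonneg _),
            ← ENNReal.ofReal_add (by positivity) (by positivity)]
          congr 1
          rw [hc₃]; ring
      _ ≤ _ := by
          refine ENNReal.ofReal_le_ofReal ((mul_le_mul_of_nonneg_right hρc hr0).trans
            (le_of_eq ?_))
          rw [← Real.rpow_add hρ0]
          congr 1
          rw [hs]; ring
  refine lt_of_lt_of_le ?_ (le_liminf_of_le (by isBoundedDefault) hmain)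
  exact_mod_cast (by linarith : d < d + γ / 4)

theorem diversityGain_nonneg {nt T nr : ℕ} {C : LDCode nt T}
    {dec : ℝ → Matrix (Fin nr) (Fin nt) ℂ → Matrix (Fin nr) (Fin T) ℂ →
      Matrix (Fin nt) (Fin T) ℂ} {d : ℝ} (hd : HasDiversityGain C dec d) : 0 ≤ d := by
  have h : (0 : EReal) ≤ d := by
    refine ge_of_tendsto hd ?_
    filter_upwards [eventually_gt_atTop 1] with ρ hρ
    have hle : channelLaw nr C ρ {ω | dec ρ ω.H ω.Y ≠ ω.X} ≤ ENNReal.ofReal (ρ ^ (-(0 : ℝ))) := by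
      rw [neg_zero, Real.rpow_zero, ENNReal.ofReal_one]
      refine (measure_mono (Set.subset_univ _)).trans ?_
      refine (measure_mono (t := {ω : Outcome nt nr T | ω.2.1 ∈ Set.univ}) (by simp)).trans ?_
      exact (channelLaw_le C ρ _).trans prob_le_one
    exact_mod_cast le_snrExponent hρ hle
  exact_mod_cast h

end SphereDecoding

theorem theorem2 (nt nr T : ℕ) (hnt : 0 < nt) (hT : 0 < T) (hnr : nt ≤ nr)
    (C : SphereDecoding.LDCode nt T) (hpower : C.PowerConstraint)
    (r : ℝ) (hr : C.HasMultiplexingGain r)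
    (dec : ℝ → Matrix (Fin nr) (Fin nt) ℂ → Matrix (Fin nr) (Fin T) ℂ →
      Matrix (Fin nt) (Fin T) ℂ)
    (hdec : SphereDecoding.IsMLDecoder C dec)
    (d : ℝ) (hd : SphereDecoding.HasDiversityGain C dec d)
    (Q : ℝ → Matrix (Fin nr) (Fin nt) ℂ → Matrix (Fin T × Fin nr) (Fin (nt * T)) ℂ)
    (R : ℝ → Matrix (Fin nr) (Fin nt) ℂ → Matrix (Fin (nt * T)) (Fin (nt * T)) ℂ)
    (hQR : ∀ ρ H, SphereDecoding.IsThinQR (C.codeChannel ρ H) (Q ρ H) (R ρ H))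
    (ξ : ℝ → ℝ) (hξ_pos : ∀ᶠ ρ in Filter.atTop, 0 < ξ ρ)
    (hξ : Filter.Tendsto (fun ρ : ℝ => Real.log (ξ ρ) / Real.log ρ) Filter.atTop (nhds 0)) :
    ∃ cbar : ℝ,
      IsGreatest (SphereDecoding.objective nt T r '' SphereDecoding.feasibleLevels nt nr d)
        cbar ∧
      SphereDecoding.sdComplexityExponent C ξ Q R d ≤ (cbar : EReal) := by
  obtain ⟨c, hc⟩ := SphereDecoding.exists_isGreatest_objective T hnr r
    (SphereDecoding.diversityGain_nonneg hd)
  refine ⟨c, hc, EReal.le_of_forall_lt_iff_le.1 fun x hx => sInf_le ⟨x, ?_, rfl⟩⟩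
  exact SphereDecoding.lt_Psi hnt hT hnr C hpower hr Q R hQR hξ_pos hξ hc.2
    (by exact_mod_cast hx)
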